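/- Graphs are finite undirected multigraphs: multiple edges and loops are allowed, and an isomorphism is a pair of bijections, on vertices and on edges, respecting incidence. The rank $n$ of a graph $\Gamma$ is its number of vertices. Its generalised Cartan matrix is $C_\Gamma = 2\,\mathrm{Id} - A_\Gamma$, where $(A_\Gamma)_{vw}$ is the number of edges joining $v$ and $w$ if $v\neq w$, and $(A_\Gamma)_{vv}$ is twice the number of loops at $v$. The graph $\Gamma$ is of finite type if $C_\Gamma$ is positive definite, of affine type if $C_\Gamma$ is positive semidefinite but not positive definite, and wild otherwise. It is of hyperbolic type if it is wild and every proper full (induced) subgraph is of finite or affine type. The extended ADE diagrams are the following: $\widetilde A_m$ ($m\ge1$), the cycle with $m+1$ vertices (two vertices joined by two edges if $m=1$); $\widetilde D_m$ ($m\ge4$), a chain of $m-3$ vertices with two leaves attached at each end (four leaves on a single vertex if $m=4$); and $\widetilde E_6,\widetilde E_7,\widetilde E_8$, the trees with one trivalent vertex and three arms with $(2,2,2)$, $(1,3,3)$, $(1,2,5)$ further vertices. The extended vertex is any vertex of $\widetilde A_m$, any leaf of $\widetilde D_m$, and the end of a longest arm of $\widetilde E_m$. The overextended diagrams $\widehat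 A_m,\widehat D_m,\widehat E_m$ arise by joining one new vertex $\infty$ by a single edge to the extended vertex. **Proposition.** A finite graph is connected and of hyperbolic type if and only if it is isomorphic to one of the following. 1. The overextended ADE diagrams $\widehat A_m$ ($1\le m\le7$), $\widehat D_m$ ($4\le m\le8$), $\widehat E_6$, $\widehat E_7$, $\widehat E_8$. 2. The infinite families: $\mathrm{Loop}_m$ ($m\ge2$), one vertex with $m$ loops; $\mathrm{Kronecker}_m$ ($m\ge3$), two vertices joined by $m$ edges; $\mathrm{Kronecker}_{m,1}$ and $\mathrm{Kronecker}_{m,2}$ ($m\ge1$), two vertices joined by $m$ edges with one loop at exactly one vertex, respectively one loop at each vertex. 3. The exceptional graphs: $\widehat A_{1,1}$, a chain of three vertices with both edges doubled; $\widetilde A_{2,1},\widetilde A_{2,2},\widetilde A_{2,3}$, a triangle with one, two, three sides doubled; $\widehat A_{2,1}$ and $\widehat A_{2,2}$, a triangle with a fourth vertex $\infty$ joined by single edges to two, respectively three, of its vertices; $\widehat A_{3,1}$, a $4$-cycle with a fifth vertex $\infty$ joined by single edges to two opposite vertices; and $\mathrm{Star}_5$, one vertex joined to five leaves. In particular the rank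 of a connected graph of hyperbolic type is at most $10$. By rank, the diagrams listed above are exactly the following: $$\begin{array}{c|l} 1 & \mathrm{Loop}_m\ (m\ge2)\\ 2 & \mathrm{Kronecker}_m\ (m\ge3),\ \mathrm{Kronecker}_{m,1}\ (m\ge1),\ \mathrm{Kronecker}_{m,2}\ (m\ge1)\\ 3 & \widehat A_1,\ \widehat A_{1,1},\ \widetilde A_{2,1},\ \widetilde A_{2,2},\ \widetilde A_{2,3}\\ 4 & \widehat A_2,\ \widehat A_{2,1},\ \widehat A_{2,2}\\ 5 & \widehat A_3,\ \widehat A_{3,1}\\ 6 & \widehat A_4,\ \widehat D_4,\ \mathrm{Star}_5\\ 7 & \widehat A_5,\ \widehat D_5\\ 8 & \widehat A_6,\ \widehat D_6,\ \widehat E_6\\ 9 & \widehat A_7,\ \widehat D_7,\ \widehat E_7\\ 10 & \widehat D_8,\ \widehat E_8 \end{array}$$ Moreover, deleting the vertex $\infty$ from $\widehat X_m$ leaves the extended diagram $\widetilde X_m$, and deleting $\infty$ (in $\widehat A_{1,1}$: an end of the chain) from $\widehat A_{m,k}$ leaves $\widetilde A_m$. -/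

import Mathlib

namespace Graph

variable {α β γ δ : Type*}

/-- A multigraph (multiple edges and loops allowed) is connected if it has a vertex and any two
vertices are joined by a finite chain of adjacent vertices. -/
def IsConnected (G : Graph α β) : Prop :=
  V(G).Nonempty ∧ ∀ x ∈ V(G), ∀ y ∈ V(G), Relation.ReflTransGen G.Adj x y

/-- The rank of a graph is its number of vertices. -/
noncomputable def rank (G : Graph α β) : ℕ := V(G).ncard

/-- Two multigraphs are isomorphic: there are bijections on vertices and on edges
that respect incidence. -/
def IsIsomorphic (G : Graph α β) (H : Graph γ δ) : Prop :=
  ∃ (f : V(G) ≃ V(H)) (g : E(G) ≃ E(H)), ∀ (e : E(G)) (x y : V(G)),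
    G.IsLink e x y ↔ H.IsLink (g e) (f x) (f y)

open Classical in
/-- The adjacency matrix of a (finite) multigraph: off the diagonal the number of edges joining
the two vertices, on the diagonal twice the number of loops. -/
noncomputable def adjacencyMatrix (G : Graph α β) : Matrix V(G) V(G) ℤ :=
  fun v w => (if v = w then 2 else 1) * ({e | G.IsLink e v w}.ncard : ℤ)

open Classical in
/-- The generalised Cartan matrix `2 - A`, where `A` is the adjacency matrix. -/
noncomputable def cartanMatrix (G : Graph α β) : Matrix V(G) V(G) ℤ :=
  2 • (1 : Matrix V(G) V(G) ℤ) - G.adjacencyMatrix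

/-- The generalised Cartan matrix, with entries regarded as real numbers. -/
noncomputable def realCartanMatrix (G : Graph α β) : Matrix V(G) V(G) ℝ :=
  G.cartanMatrix.map (Int.cast : ℤ → ℝ)

/-- Finite type: the generalised Cartan matrix is positive definite. -/
def IsFiniteType (G : Graph α β) : Prop := G.realCartanMatrix.PosDef

/-- Affine (tame) type: the generalised Cartan matrix is positive semidefinite, but not positive
definite. -/
def IsAffineType (G : Graph α β) : Prop :=
  G.realCartanMatrix.PosSemidef ∧ ¬ G.realCartanMatrix.PosDef

/-- Wild type: the remaining case, where the generalised Cartan matrix is not positive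
semidefinite. -/
def IsWild (G : Graph α β) : Prop := ¬ G.realCartanMatrix.PosSemidef

/-- Hyperbolic type: a wild graph all of whose proper full (that is, induced) subgraphs are of
finite or affine type. -/
def IsHyperbolic (G : Graph α β) : Prop :=
  G.IsWild ∧ ∀ H : Graph α β, H.IsInducedSubgraph G → H ≠ G → H.IsFiniteType ∨ H.IsAffineType

/-- The multigraph with vertices `0, …, n - 1` and one edge for each entry of the list `l`: the
entry `(x, y)` is an edge joining `x` and `y`. -/
def ofEdges (n : ℕ) (l : List (ℕ × ℕ)) : Graph ℕ ℕ where
  vertexSet := {v | v < n}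
  IsLink e x y := x < n ∧ y < n ∧ (l[e]? = some (x, y) ∨ l[e]? = some (y, x))
  isLink_symm := fun _ _ => ⟨fun _ _ h => ⟨h.2.1, h.1, h.2.2.symm⟩⟩
  eq_or_eq_of_isLink_of_isLink := by
    rintro e x y v w ⟨-, -, h⟩ ⟨-, -, h'⟩
    rcases h with h | h <;> rcases h' with h' | h' <;> rw [h] at h' <;>
      simp only [Option.some.injEq, Prod.mk.injEq] at h' <;> tauto
  left_mem_of_isLink := fun _ _ _ h => h.1

end Graph

/-- Labels for the extended (affine) ADE diagrams. -/
inductive ExtendedADE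
  | A (n : ℕ)
  | D (n : ℕ)
  | E6
  | E7
  | E8

namespace ExtendedADE

/-- The admissible indices: extended `A n` for `n ≥ 1`, extended `D n` for `n ≥ 4`, and extended
`E6`, `E7`, `E8`. -/
def IsValid : ExtendedADE → Prop
  | A n => 1 ≤ n
  | D n => 4 ≤ n
  | _ => True

/-- The number of vertices. -/
def order : ExtendedADE → ℕ
  | A n => n + 1
  | D n => n + 1
  | E6 => 7
  | E7 => 8
  | E8 => 9

/-- The list of edges. The extended vertex is always `0`, and the vertices `1, 2, …` form the
underlying finite type diagram. Extended `A n` is a cycle with `n + 1` vertices (two vertices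
joined by two edges if `n = 1`). Extended `D n` is the chain `2, …, n - 2` with two leaves `0, 1`
attached to `2` and two leaves `n - 1, n` attached to `n - 2`. -/
def edges : ExtendedADE → List (ℕ × ℕ)
  | A n => (List.range (n + 1)).map fun i => (i, (i + 1) % (n + 1))
  | D n => [(0, 2), (1, 2), (n - 2, n - 1), (n - 2, n)] ++
      (List.range (n - 4)).map fun i => (i + 2, i + 3)
  | E6 => [(0, 2), (2, 4), (1, 3), (3, 4), (4, 5), (5, 6)]
  | E7 => [(0, 1), (2, 4), (1, 3), (3, 4), (4, 5), (5, 6), (6, 7)]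
  | E8 => [(0, 8), (2, 4), (1, 3), (3, 4), (4, 5), (5, 6), (6, 7), (7, 8)]

/-- The extended ADE diagram as a graph. -/
def graph (X : ExtendedADE) : Graph ℕ ℕ := Graph.ofEdges X.order X.edges

end ExtendedADE

/-- Labels for the diagrams in the classification of graphs of hyperbolic type. -/
inductive HypDiagram
  /-- the overextension of an extended ADE diagram -/
  | overext (X : ExtendedADE)
  /-- one vertex with `n` loops -/
  | loop (n : ℕ)
  /-- two vertices joined by `n` edges -/
  | kronecker (n : ℕ)
  /-- two vertices joined by `n` edges, with a loop at one of them -/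
  | kroneckerOne (n : ℕ)
  /-- two vertices joined by `n` edges, with a loop at each of them -/
  | kroneckerTwo (n : ℕ)
  /-- chain of three vertices with both edges doubled -/
  | hypA11
  /-- triangle with one side doubled -/
  | affA21
  /-- triangle with two sides doubled -/
  | affA22
  /-- triangle with three sides doubled -/
  | affA23
  /-- triangle with a fourth vertex joined to two of its vertices -/
  | hypA21
  /-- triangle with a fourth vertex joined to all its vertices -/
  | hypA22
  /-- 4-cycle with a fifth vertex joined to two opposite vertices -/
  | hypA31
  /-- one vertex joined to five leaves -/
  | star5

namespace HypDiagram

/-- The ranges of the indices that occur in the classification. -/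
def IsListed : HypDiagram → Prop
  | overext (.A n) => 1 ≤ n ∧ n ≤ 7
  | overext (.D n) => 4 ≤ n ∧ n ≤ 8
  | overext .E6 => True
  | overext .E7 => True
  | overext .E8 => True
  | loop n => 2 ≤ n
  | kronecker n => 3 ≤ n
  | kroneckerOne n => 1 ≤ n
  | kroneckerTwo n => 1 ≤ n
  | hypA11 => True
  | affA21 => True
  | affA22 => True
  | affA23 => True
  | hypA21 => True
  | hypA22 => True
  | hypA31 => True
  | star5 => True

/-- The diagrams as graphs. The overextension of an extended ADE diagram has one new vertex (the
one with the largest number), joined by a single edge to the extended vertex `0`. -/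
def graph : HypDiagram → Graph ℕ ℕ
  | overext X => Graph.ofEdges (X.order + 1) ((0, X.order) :: X.edges)
  | loop n => Graph.ofEdges 1 (List.replicate n (0, 0))
  | kronecker n => Graph.ofEdges 2 (List.replicate n (0, 1))
  | kroneckerOne n => Graph.ofEdges 2 ((0, 0) :: List.replicate n (0, 1))
  | kroneckerTwo n => Graph.ofEdges 2 ((0, 0) :: (1, 1) :: List.replicate n (0, 1))
  | hypA11 => Graph.ofEdges 3 [(0, 1), (0, 1), (0, 2), (0, 2)]
  | affA21 => Graph.ofEdges 3 [(0, 1), (0, 1), (1, 2), (2, 0)]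
  | affA22 => Graph.ofEdges 3 [(0, 1), (0, 1), (1, 2), (1, 2), (2, 0)]
  | affA23 => Graph.ofEdges 3 [(0, 1), (0, 1), (1, 2), (1, 2), (2, 0), (2, 0)]
  | hypA21 => Graph.ofEdges 4 [(0, 1), (1, 2), (2, 0), (0, 3), (1, 3)]
  | hypA22 => Graph.ofEdges 4 [(0, 1), (1, 2), (2, 0), (0, 3), (1, 3), (2, 3)]
  | hypA31 => Graph.ofEdges 5 [(0, 1), (1, 2), (2, 3), (3, 0), (0, 4), (2, 4)]
  | star5 => Graph.ofEdges 6 [(0, 1), (0, 2), (0, 3), (0, 4), (0, 5)]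

/-- The overextended vertex `∞`, for the diagrams in which one is marked, together with the
extended ADE diagram that is meant to remain when it is removed. -/
def overextendedVertex : HypDiagram → Option (ℕ × ExtendedADE)
  | overext X => some (X.order, X)
  | hypA11 => some (2, .A 1)
  | hypA21 => some (3, .A 2)
  | hypA22 => some (3, .A 2)
  | hypA31 => some (4, .A 3)
  | _ => none

/-- The table of diagrams by rank. -/
def table : ℕ → Set HypDiagram
  | 1 => {D | ∃ n ≥ 2, D = loop n}
  | 2 => {D | (∃ n ≥ 3, D = kronecker n) ∨ (∃ n ≥ 1, D = kroneckerOne n) ∨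
      ∃ n ≥ 1, D = kroneckerTwo n}
  | 3 => {overext (.A 1), hypA11, affA21, affA22, affA23}
  | 4 => {overext (.A 2), hypA21, hypA22}
  | 5 => {overext (.A 3), hypA31}
  | 6 => {overext (.A 4), overext (.D 4), star5}
  | 7 => {overext (.A 5), overext (.D 5)}
  | 8 => {overext (.A 6), overext (.D 6), overext .E6}
  | 9 => {overext (.A 7), overext (.D 7), overext .E7}
  | 10 => {overext (.D 8), overext .E8}
  | _ => ∅

end HypDiagram

/-! Write A for the adjacency matrix (loops counted twice) and consider the quadratic form of 2 − A.
Everything is controlled by vectors δ with entries in ℕ, compared with Aδ on their support. If Aδ ≤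
2δ there (superharmonic), the form is nonnegative on all vectors supported where δ ≠ 0, by a
weighted arithmetic-geometric mean inequality. If 2δ ≤ Aδ there (subharmonic) and v is a vertex
outside the support adjacent to it, the form is negative at 2δ + e_v.

The radical vectors of the extended ADE diagrams satisfy 2δ = Aδ, so they serve both purposes.
Suppose that a connected hyperbolic graph contains an extended diagram as a subgraph, full or not.
The vector 2δ + e_v cannot vanish at any vertex, since the form is nonnegative on vectors that do;
hence the diagram misses at most one vertex (`card_le_of_subharmonic`, `card_le_of_embedding`). If
it misses none and is full, the form is nonnegative, against wildness. So the graph is an extended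
diagram with one more vertex, or has few vertices and large multiplicities, and it remains to see
how the last vertex is attached.

A suitable diagram is found as follows. A loop leaves at most two vertices, a multiple edge at most
three. In a simple graph with a cycle, a shortest cycle is chordless, hence an extended A diagram.
In a tree, two branch vertices or a vertex of degree at least four give an extended D diagram, here
a forked path, chosen with shortest spine. A tree with a single branch vertex, of degree three,
contains an extended E diagram unless two of its arms have length one or it is one of E6, E7, E8; a
tree without branch vertex is a path. These exceptions are not wild. The bounds on the indices of
the A and D families come from a second diagram, extended E7 in a long cycle with a pendant vertex
and extended E8 in a long forked path with an extra vertex on a leaf: each would miss two vertices.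

Conversely, a listed diagram is shown to be hyperbolic by one vector with negative form and, for
every vertex k, a superharmonic vector with support the complement of k. -/

/-! ### Superharmonic and subharmonic vectors for the form of 2 − A -/

section Form

variable {V : Type*} [Fintype V]

/-- The quadratic form of `2 - a`, for a matrix `a` with entries in `ℕ`. -/
def cartanForm (a : V → V → ℕ) (x : V → ℝ) : ℝ := ∑ v, x v * (2 * x v - ∑ w, a v w * x w)

/-- The matrix `a` is the adjacency matrix of a graph of hyperbolic type. -/
def IsHyperbolicMatrix (a : V → V → ℕ) : Prop :=
  (∃ x, cartanForm a x < 0) ∧ ∀ x v, x v = 0 → 0 ≤ cartanForm a x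

/-- The matrix `a` is the adjacency matrix of a connected graph. -/
def IsConnectedMatrix (a : V → V → ℕ) : Prop :=
  Nonempty V ∧ ∀ S : Set V, S.Nonempty → (∀ u ∈ S, ∀ v, a u v ≠ 0 → v ∈ S) → S = Set.univ

/-- The cross terms are bounded by 2 x_v x_w ≤ (δ_w/δ_v) x_v² + (δ_v/δ_w) x_w². Summed against the
symmetric matrix `a`, this gives x_v² the coefficient (Aδ)_v/δ_v, which is at most 2. Zeros of δ are
allowed so that the same lemma serves for subgraphs obtained by deleting vertices. -/
theorem cartanForm_nonneg_of_superharmonic {a : V → V → ℕ} (ha : ∀ v w, a v w = a w v) (δ : V → ℕ)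
    (hδ : ∀ v, δ v ≠ 0 → ∑ w, a v w * δ w ≤ 2 * δ v) (x : V → ℝ) (hx : ∀ v, δ v = 0 → x v = 0) :
    0 ≤ cartanForm a x := by
  have key : ∀ v w, 2 * (x v * (a v w * x w)) ≤
      a v w * ((δ w : ℝ) / δ v * x v ^ 2) + a v w * ((δ v : ℝ) / δ w * x w ^ 2) := by
    intro v w
    by_cases hv : δ v = 0
    · simp [hx v hv, hv]
    by_cases hw : δ w = 0
    · simp [hx w hw, hw]
    have hv' : (0 : ℝ) < δ v := by positivity
    have hw' : (0 : ℝ) < δ w := by positivity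
    have h : 2 * (x v * x w) ≤ (δ w : ℝ) / δ v * x v ^ 2 + (δ v : ℝ) / δ w * x w ^ 2 := by
      have e : (δ w : ℝ) / δ v * x v ^ 2 + (δ v : ℝ) / δ w * x w ^ 2 - 2 * (x v * x w)
          = (δ w * x v - δ v * x w) ^ 2 / (δ v * δ w) := by
        field_simp
        ring
      have : 0 ≤ (δ w * x v - δ v * x w) ^ 2 / ((δ v : ℝ) * δ w) := by positivity
      linarith
    calc 2 * (x v * (a v w * x w)) = a v w * (2 * (x v * x w)) := by ring
      _ ≤ a v w * ((δ w : ℝ) / δ v * x v ^ 2 + (δ v : ℝ) / δ w * x w ^ 2) := by gcongr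
      _ = _ := by ring
  have s1 : ∑ v, ∑ w, 2 * (x v * (a v w * x w)) ≤
      ∑ v, ∑ w, a v w * ((δ w : ℝ) / δ v * x v ^ 2) +
        ∑ v, ∑ w, a v w * ((δ v : ℝ) / δ w * x w ^ 2) := by
    simp_rw [← Finset.sum_add_distrib]
    exact Finset.sum_le_sum fun v _ => Finset.sum_le_sum fun w _ => key v w
  have s2 : ∑ v, ∑ w, (a v w * ((δ v : ℝ) / δ w * x w ^ 2)) =
      ∑ v, ∑ w, a v w * ((δ w : ℝ) / δ v * x v ^ 2) := by
    rw [Finset.sum_comm]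
    exact Finset.sum_congr rfl fun v _ => Finset.sum_congr rfl fun w _ => by rw [ha]
  have s3 : ∑ v, ∑ w, a v w * ((δ w : ℝ) / δ v * x v ^ 2) ≤ ∑ v, 2 * x v ^ 2 := by
    refine Finset.sum_le_sum fun v _ => ?_
    by_cases hv : δ v = 0
    · simp [hx v hv]
    have hv' : (0 : ℝ) < δ v := by positivity
    have h : ∑ w, (a v w : ℝ) * δ w ≤ 2 * δ v := by exact_mod_cast hδ v hv
    calc ∑ w, a v w * ((δ w : ℝ) / δ v * x v ^ 2)
        = (∑ w, (a v w : ℝ) * δ w) * (x v ^ 2 / δ v) := by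
          rw [Finset.sum_mul]
          refine Finset.sum_congr rfl fun w _ => ?_
          field_simp
      _ ≤ 2 * δ v * (x v ^ 2 / δ v) := by gcongr
      _ = 2 * x v ^ 2 := by field_simp
  have s4 : cartanForm a x = ∑ v, 2 * x v ^ 2 - (∑ v, ∑ w, 2 * (x v * (a v w * x w))) / 2 := by
    rw [cartanForm, Finset.sum_div, ← Finset.sum_sub_distrib]
    refine Finset.sum_congr rfl fun v _ => ?_
    rw [← Finset.mul_sum, ← Finset.mul_sum]
    ring
  rw [s4]
  linarith

/-- The witness is y = 2δ + e_v. A vertex w of the support contributes at most −2 δ_w a_{wv}, which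
is at most −2 for w = u. The vertex v contributes at most 2 − 2(Aδ)_v, and (Aδ)_v ≥ a_{vu} δ_u ≥ 1;
the factor 2 in front of δ is there to make this term nonpositive. -/
theorem exists_cartanForm_neg_of_ne_univ {a : V → V → ℕ} (ha : ∀ v w, a v w = a w v) {δ : V → ℕ}
    (hδ : ∀ v, δ v ≠ 0 → 2 * δ v ≤ ∑ w, a v w * δ w) {u v : V} (hu : δ u ≠ 0) (hv : δ v = 0)
    (huv : a u v ≠ 0) :
    ∃ x : V → ℝ, cartanForm a x < 0 ∧ ∀ w, w ≠ v → δ w = 0 → x w = 0 := by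
  classical
  let y : V → ℤ := fun w => 2 * δ w + if w = v then 1 else 0
  have hy : ∀ w, ∑ z, (a w z : ℤ) * y z = 2 * ∑ z, (a w z : ℤ) * δ z + a w v := by
    intro w
    simp only [y, mul_add, Finset.sum_add_distrib, Finset.mul_sum]
    congr 1
    · exact Finset.sum_congr rfl fun z _ => by ring
    · simp
  have key : ∀ w, y w * (2 * y w - ∑ z, (a w z : ℤ) * y z) ≤ if w = u then -2 else 0 := by
    intro w
    rw [hy]
    by_cases hw : δ w = 0
    · have hwu : w ≠ u := fun h => hu (h ▸ hw)
      by_cases hwv : w = v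
      · subst hwv
        have h1 : (a w u : ℤ) * δ u ≤ ∑ z, (a w z : ℤ) * δ z :=
          Finset.single_le_sum (f := fun z => (a w z : ℤ) * δ z) (fun z _ => by positivity)
            (Finset.mem_univ u)
        have h2 : (1 : ℤ) ≤ a w u * δ u := by
          rw [ha w u]
          exact_mod_cast Nat.one_le_iff_ne_zero.2 (mul_ne_zero huv hu)
        simp only [y, hv, hwu]
        simp
        omega
      · simp [y, hw, hwv, hwu]
    · have hwv : w ≠ v := fun h => hw (h ▸ hv)
      have h1 : (2 * δ w : ℤ) ≤ ∑ z, (a w z : ℤ) * δ z := by exact_mod_cast hδ w hw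
      have h2 : (1 : ℤ) ≤ δ w := by exact_mod_cast Nat.one_le_iff_ne_zero.2 hw
      simp only [y, hwv, if_false, add_zero]
      split_ifs with hwu
      · subst hwu
        have h3 : (1 : ℤ) ≤ a w v := by exact_mod_cast Nat.one_le_iff_ne_zero.2 huv
        nlinarith
      · have h3 : (0 : ℤ) ≤ a w v := by positivity
        nlinarith
  refine ⟨fun w => y w, ?_, fun w h1 h2 => by simp [y, h1, h2]⟩
  have h : ∑ w, y w * (2 * y w - ∑ z, (a w z : ℤ) * y z) < 0 := by
    refine (Finset.sum_le_sum fun w _ => key w).trans_lt ?_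
    simp
  rw [cartanForm]
  exact_mod_cast h

/-- In a connected graph of hyperbolic type, a subgraph of affine type (not necessarily full)
misses at most one vertex. -/
theorem card_le_of_subharmonic [DecidableEq V] {a : V → V → ℕ} (ha : ∀ v w, a v w = a w v)
    (hc : IsConnectedMatrix a) (hh : IsHyperbolicMatrix a) {δ : V → ℕ} {S : Finset V}
    (hS : ∀ v, v ∈ S ↔ δ v ≠ 0) (hne : S.Nonempty)
    (hδ : ∀ v ∈ S, 2 * δ v ≤ ∑ w, a v w * δ w) :
    S = Finset.univ ∨ ∃ v ∉ S, (∃ u ∈ S, a u v ≠ 0) ∧ ∀ w, w ∈ insert v S := by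
  by_contra! hcon
  obtain ⟨h1, h2⟩ := hcon
  have h3 : ∃ u ∈ S, ∃ v, a u v ≠ 0 ∧ v ∉ S := by
    by_contra! h
    have := hc.2 (S : Set V) (by simpa using hne) (by simpa using h)
    exact h1 (by simpa using this)
  obtain ⟨u, hu, v, huv, hv⟩ := h3
  obtain ⟨w, hw⟩ := h2 v hv ⟨u, hu, huv⟩
  simp only [Finset.mem_insert, not_or] at hw
  obtain ⟨x, hx, hx0⟩ := exists_cartanForm_neg_of_ne_univ ha (δ := δ)
    (fun v hv => hδ v ((hS v).2 hv)) ((hS u).1 hu) (by simpa [hS] using hv) huv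
  exact absurd (hh.2 x w (hx0 w hw.1 (by simpa [hS] using hw.2))) (not_le.2 hx)

/-- The form in which `card_le_of_subharmonic` is applied. Only `b ≤ a` is required, because further
edges increase Aδ and so preserve the inequality 2δ ≤ Aδ; the diagram `b` need not be a full
subgraph. -/
theorem card_le_of_embedding {a : V → V → ℕ} (ha : ∀ v w, a v w = a w v)
    (hc : IsConnectedMatrix a) (hh : IsHyperbolicMatrix a) {n : ℕ} (f : Fin n → V)
    (hf : f.Injective) (b : Fin n → Fin n → ℕ) (hb : ∀ i j, b i j ≤ a (f i) (f j))
    (δ : Fin n → ℕ) (hn : 0 < n) (hpos : ∀ i, δ i ≠ 0) (hδ : ∀ i, 2 * δ i ≤ ∑ j, b i j * δ j) :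
    Set.range f = Set.univ ∨
      ∃ v ∉ Set.range f, (∃ i, a (f i) v ≠ 0) ∧ ∀ w, w = v ∨ w ∈ Set.range f := by
  classical
  let δ' : V → ℕ := Function.extend f δ 0
  have h0 : ∀ v, v ∈ Finset.univ.image f ↔ δ' v ≠ 0 := by
    intro v
    by_cases h : ∃ i, f i = v
    · obtain ⟨i, rfl⟩ := h
      simp [δ', hf.extend_apply, hpos]
    · simp [δ', not_exists.1 h]
  have h1 := card_le_of_subharmonic ha hc hh (δ := δ') h0 ⟨f ⟨0, hn⟩, by simp⟩ (by
    intro v hv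
    simp only [Finset.mem_image, Finset.mem_univ, true_and] at hv
    obtain ⟨i, rfl⟩ := hv
    calc 2 * δ' (f i) = 2 * δ i := by simp [δ', hf.extend_apply]
      _ ≤ ∑ j, b i j * δ j := hδ i
      _ ≤ ∑ j, a (f i) (f j) * δ' (f j) := by
        refine Finset.sum_le_sum fun j _ => ?_
        simp only [δ', hf.extend_apply]
        exact Nat.mul_le_mul_right _ (hb i j)
      _ = ∑ w ∈ Finset.univ.image f, a (f i) w * δ' w := by
        rw [Finset.sum_image fun _ _ _ _ h => hf h]
      _ ≤ _ := Finset.sum_le_sum_of_subset (Finset.subset_univ _))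
  rcases h1 with h1 | ⟨v, hv, ⟨u, hu, huv⟩, hall⟩
  · left
    have := congrArg (fun s : Finset V => (s : Set V)) h1
    simpa using this
  · right
    simp only [Finset.mem_image, Finset.mem_univ, true_and] at hu
    obtain ⟨i, rfl⟩ := hu
    exact ⟨v, by simpa using hv, ⟨i, huv⟩, by simpa using hall⟩

/-- Used to exclude that a finite or affine diagram is the whole graph. In contrast to
`card_le_of_embedding`, the inequality must hold for the entries of `a` itself. -/
theorem cartanForm_nonneg_of_bijective {a : V → V → ℕ} (ha : ∀ v w, a v w = a w v) {n : ℕ}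
    (f : Fin n → V) (hf : f.Bijective) (δ : Fin n → ℕ) (hpos : ∀ i, δ i ≠ 0)
    (hδ : ∀ i, ∑ j, a (f i) (f j) * δ j ≤ 2 * δ i) (x : V → ℝ) : 0 ≤ cartanForm a x := by
  let e := Equiv.ofBijective f hf
  refine cartanForm_nonneg_of_superharmonic ha (fun v => δ (e.symm v)) (fun v _ => ?_) x
    (fun v h => absurd h (hpos _))
  obtain ⟨i, rfl⟩ := e.surjective v
  rw [← e.sum_comp]
  simp only [Equiv.symm_apply_apply]
  exact hδ i

end Form

/-! ### Relabelling vertices and restricting to subgraphs -/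

section Transfer

variable {V W : Type*}

theorem IsConnectedMatrix.of_equiv {a : V → V → ℕ} {b : W → W → ℕ} (e : V ≃ W)
    (h : ∀ v w, a v w = b (e v) (e w)) (hb : IsConnectedMatrix b) : IsConnectedMatrix a := by
  obtain ⟨h1, h2⟩ := hb
  refine ⟨e.nonempty_congr.2 h1, fun S hS hcl => ?_⟩
  have := h2 (e '' S) (hS.image e) (by
    rintro _ ⟨u, hu, rfl⟩ v huv
    obtain ⟨v, rfl⟩ := e.surjective v
    exact ⟨v, hcl u hu v (by rwa [h]), rfl⟩)
  rw [Set.image_eq_iff_surjOn_mapsTo] at this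
  refine Set.eq_univ_of_forall fun v => ?_
  obtain ⟨u, hu, huv⟩ := this.1 (Set.mem_univ (e v))
  exact e.injective huv ▸ hu

variable [Fintype V] [Fintype W]

/-- The form of a full subgraph is the form of the whole graph on vectors extended by zero. -/
theorem cartanForm_comp_of_injective {a : V → V → ℕ} {b : W → W → ℕ} {f : V → W}
    (hf : f.Injective) (h : ∀ v w, a v w = b (f v) (f w)) (x : W → ℝ)
    (hx : ∀ w ∉ Set.range f, x w = 0) : cartanForm a (x ∘ f) = cartanForm b x := by
  refine Fintype.sum_of_injective f hf _ _ (fun w hw => by simp [hx w hw]) fun v => ?_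
  rw [Fintype.sum_of_injective f hf _ (fun w => (b (f v) w : ℝ) * x w)
    (fun w hw => by simp [hx w hw]) fun w => by rw [h]; rfl]
  rfl

theorem cartanForm_comp_equiv {a : V → V → ℕ} {b : W → W → ℕ} (e : V ≃ W)
    (h : ∀ v w, a v w = b (e v) (e w)) (x : W → ℝ) :
    cartanForm a (x ∘ e) = cartanForm b x :=
  cartanForm_comp_of_injective e.injective h x fun w hw => absurd (e.surjective w) hw

theorem IsHyperbolicMatrix.of_equiv {a : V → V → ℕ} {b : W → W → ℕ} (e : V ≃ W)
    (h : ∀ v w, a v w = b (e v) (e w)) (hb : IsHyperbolicMatrix b) : IsHyperbolicMatrix a := by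
  obtain ⟨⟨x, hx⟩, h2⟩ := hb
  refine ⟨⟨x ∘ e, by rwa [cartanForm_comp_equiv e h]⟩, fun y v hy => ?_⟩
  have := h2 (y ∘ e.symm) (e v) (by simpa using hy)
  rwa [← cartanForm_comp_equiv e h, Function.comp_assoc, e.symm_comp_self] at this

end Transfer

/-! ### From multigraphs to adjacency matrices -/

namespace Graph

variable {α β γ δ : Type*}

/-- The number of edges joining `x` and `y`. -/
noncomputable def mult (G : Graph α β) (x y : α) : ℕ := {e | G.IsLink e x y}.ncard

open Classical in
/-- The adjacency matrix of a multigraph, with entries in `ℕ`. -/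
noncomputable def adjCount (G : Graph α β) (v w : V(G)) : ℕ :=
  (if v = w then 2 else 1) * G.mult v w

theorem mult_comm (G : Graph α β) (x y : α) : G.mult x y = G.mult y x := by
  simp only [mult, G.isLink_comm]

theorem adjCount_comm (G : Graph α β) (v w : V(G)) : G.adjCount v w = G.adjCount w v := by
  by_cases h : v = w
  · rw [h]
  · simp [adjCount, h, Ne.symm h, G.mult_comm v]

theorem mult_ne_zero_iff {G : Graph α β} (hE : E(G).Finite) {x y : α} :
    G.mult x y ≠ 0 ↔ G.Adj x y := by
  rw [mult, ← Nat.pos_iff_ne_zero, Set.ncard_pos (hE.subset fun e he => he.edge_mem)]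
  rfl

theorem adjCount_ne_zero_iff {G : Graph α β} (hE : E(G).Finite) {v w : V(G)} :
    G.adjCount v w ≠ 0 ↔ G.Adj v w := by
  rw [← mult_ne_zero_iff hE, adjCount]
  split_ifs <;> simp

theorem isConnected_iff {G : Graph α β} (hE : E(G).Finite) :
    G.IsConnected ↔ IsConnectedMatrix G.adjCount := by
  rw [IsConnected, IsConnectedMatrix, Set.nonempty_coe_sort]
  refine and_congr_right fun hne => ⟨fun h S ⟨u, hu⟩ hcl => ?_, fun h x hx y hy => ?_⟩
  · refine Set.eq_univ_of_forall fun v => ?_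
    have key : ∀ y, Relation.ReflTransGen G.Adj u y → ∃ hy : y ∈ V(G), (⟨y, hy⟩ : V(G)) ∈ S := by
      intro y hy
      induction hy with
      | refl => exact ⟨u.2, hu⟩
      | @tail b c _ hbc ih =>
        obtain ⟨hb, hbS⟩ := ih
        exact ⟨hbc.right_mem, hcl _ hbS ⟨c, hbc.right_mem⟩ ((adjCount_ne_zero_iff hE).2 hbc)⟩
    exact (key v (h u u.2 v v.2)).2
  · have := h {v | Relation.ReflTransGen G.Adj x v} ⟨⟨x, hx⟩, .refl⟩ fun u hu v huv =>
      Relation.ReflTransGen.tail hu ((adjCount_ne_zero_iff hE).1 huv)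
    have h2 := Set.mem_univ (⟨y, hy⟩ : V(G))
    rw [← this] at h2
    exact h2

open Classical in
theorem realCartanMatrix_apply (G : Graph α β) (v w : V(G)) :
    G.realCartanMatrix v w = (if v = w then 2 else 0) - G.adjCount v w := by
  simp only [realCartanMatrix, cartanMatrix, adjacencyMatrix, adjCount, mult, Matrix.map_apply,
    Matrix.sub_apply, Matrix.smul_apply, Matrix.one_apply]
  split_ifs <;> simp

theorem posSemidef_realCartanMatrix_iff (G : Graph α β) [Fintype V(G)] :
    G.realCartanMatrix.PosSemidef ↔ ∀ x, 0 ≤ cartanForm G.adjCount x := by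
  classical
  rw [Matrix.posSemidef_iff_dotProduct_mulVec]
  have h1 : G.realCartanMatrix.IsHermitian := by
    refine Matrix.IsHermitian.ext fun v w => ?_
    rw [realCartanMatrix_apply, realCartanMatrix_apply, G.adjCount_comm, star_trivial]
    simp only [eq_comm]
  rw [and_iff_right h1]
  refine forall_congr' fun x => ?_
  have h2 : star x ⬝ᵥ (G.realCartanMatrix.mulVec x) = cartanForm G.adjCount x := by
    refine Finset.sum_congr rfl fun v _ => ?_
    have : G.realCartanMatrix.mulVec x v = ∑ w, G.realCartanMatrix v w * x w := rfl
    simp [this, realCartanMatrix_apply, sub_mul, Finset.sum_sub_distrib]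
  rw [h2]

theorem isFiniteType_or_isAffineType_iff (G : Graph α β) :
    G.IsFiniteType ∨ G.IsAffineType ↔ G.realCartanMatrix.PosSemidef := by
  constructor
  · rintro (h | h)
    exacts [h.posSemidef, h.1]
  · intro h
    by_cases h' : G.realCartanMatrix.PosDef
    exacts [.inl h', .inr ⟨h, h'⟩]

theorem IsInducedSubgraph.adjCount_eq {G H : Graph α β} (h : H.IsInducedSubgraph G) (v w : V(H)) :
    H.adjCount v w = G.adjCount ⟨v, h.le.vertexSet_mono v.2⟩ ⟨w, h.le.vertexSet_mono w.2⟩ := by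
  have e : ∀ e, H.IsLink e v w ↔ G.IsLink e v w := fun e => h.isLink_congr v.2 w.2
  have e' : ∀ v' w' : V(G), v'.1 = v.1 → w'.1 = w.1 → H.adjCount v w = G.adjCount v' w' := by
    rintro ⟨v', hv⟩ ⟨w', hw⟩ rfl rfl
    simp only [adjCount, mult, e]
    congr 1
    classical exact ite_congr (by rw [Subtype.ext_iff, Subtype.mk_eq_mk]) (fun _ => rfl) fun _ => rfl
  exact e' _ _ rfl rfl

theorem deleteVerts_isInducedSubgraph (G : Graph α β) (X : Set α) :
    (G.deleteVerts X).IsInducedSubgraph G where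
  le := deleteVerts_le
  isLink_of_mem_mem e x y h hx hy := by simp_all

/-- It suffices to delete single vertices: a proper full subgraph misses some vertex v, and a vector
on it, extended by zero, vanishes at v. Conversely, vectors vanishing at v are vectors on the full
subgraph with v deleted. -/
theorem isHyperbolic_iff {G : Graph α β} [Fintype V(G)] :
    G.IsHyperbolic ↔ IsHyperbolicMatrix G.adjCount := by
  classical
  simp only [IsHyperbolic, IsHyperbolicMatrix, IsWild, isFiniteType_or_isAffineType_iff,
    posSemidef_realCartanMatrix_iff, not_forall, not_le]
  have key : ∀ H : Graph α β, H.IsInducedSubgraph G → ∀ _ : Fintype V(H), ∀ x : V(G) → ℝ,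
      (∀ v : V(G), v.1 ∉ V(H) → x v = 0) → ∃ y : V(H) → ℝ,
        cartanForm H.adjCount y = cartanForm G.adjCount x := by
    intro H hH _ x hx
    refine ⟨_, cartanForm_comp_of_injective
      (f := fun v : V(H) => (⟨v, hH.le.vertexSet_mono v.2⟩ : V(G)))
      (fun v w h => Subtype.ext (Subtype.mk.inj h)) hH.adjCount_eq x fun w hw => hx w ?_⟩
    exact fun h => hw ⟨⟨w, h⟩, rfl⟩
  refine and_congr_right fun _ => ⟨fun h x v hx => ?_, fun h H hH hne => ?_⟩
  · have hi := G.deleteVerts_isInducedSubgraph {v.1}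
    have := Fintype.ofFinite V(G)
    have hV : V(G.deleteVerts {v.1}) = V(G) \ {v.1} := by simp
    have hfin : Finite V(G.deleteVerts {v.1}) := (Set.toFinite V(G)).subset hi.le.vertexSet_mono
    have := Fintype.ofFinite V(G.deleteVerts {v.1})
    have h1 := h _ hi fun e => by
      have hv : v.1 ∉ V(G.deleteVerts {v.1}) := by simp
      exact hv (e.symm ▸ v.2)
    rw [posSemidef_realCartanMatrix_iff] at h1
    obtain ⟨y, hy⟩ := key _ hi inferInstance x fun w hw => by
      rw [hV] at hw
      have : w = v := Subtype.ext (by simpa using hw)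
      rw [this, hx]
    rw [← hy]
    exact h1 y
  · have hfin : Finite V(H) := (Set.toFinite V(G)).subset hH.le.vertexSet_mono
    have := Fintype.ofFinite V(H)
    rw [posSemidef_realCartanMatrix_iff]
    intro y
    have h2 : ∃ v ∈ V(G), v ∉ V(H) := by
      by_contra! hcon
      exact hne (hH.ext_of_vertexSet (hH.le.vertexSet_mono.antisymm hcon))
    obtain ⟨v, hv, hvH⟩ := h2
    let f : V(H) → V(G) := fun v => ⟨v, hH.le.vertexSet_mono v.2⟩
    have hf : f.Injective := fun v w h => Subtype.ext (Subtype.mk.inj h)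
    have hy := cartanForm_comp_of_injective hf hH.adjCount_eq (Function.extend f y 0)
      fun w hw => Function.extend_apply' _ _ _ hw
    rw [Function.extend_comp hf] at hy
    rw [hy]
    refine h _ ⟨v, hv⟩ (Function.extend_apply' _ _ _ ?_)
    rintro ⟨w, hw⟩
    exact hvH (Subtype.mk.inj hw ▸ w.2)

theorem exists_ends (G : Graph α β) : ∃ t : E(G) → Sym2 V(G),
    ∀ (e : E(G)) (v w : V(G)), G.IsLink e v w ↔ t e = s(v, w) := by
  have : ∀ e : E(G), ∃ t : Sym2 V(G), ∀ (v w : V(G)), G.IsLink e v w ↔ t = s(v, w) := by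
    intro e
    obtain ⟨x, y, hxy⟩ := G.exists_isLink_of_mem_edgeSet e.2
    refine ⟨s(⟨x, hxy.left_mem⟩, ⟨y, hxy.right_mem⟩), fun v w => ?_⟩
    rw [hxy.isLink_iff_sym2_eq, Sym2.eq_iff, Sym2.eq_iff]
    simp [Subtype.ext_iff]
  choose t ht using this
  exact ⟨t, ht⟩

theorem mult_eq_card_fiber {G : Graph α β} {t : E(G) → Sym2 V(G)}
    (ht : ∀ (e : E(G)) (v w : V(G)), G.IsLink e v w ↔ t e = s(v, w)) (v w : V(G)) :
    G.mult v w = Nat.card {e // t e = s(v, w)} := by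
  rw [mult, ← Nat.card_coe_set_eq]
  refine Nat.card_congr ⟨fun e => ⟨⟨e, e.2.edge_mem⟩, (ht ⟨e, e.2.edge_mem⟩ v w).1 e.2⟩,
    fun e => ⟨e.1, (ht e.1 v w).2 e.2⟩, fun e => rfl, fun e => rfl⟩

/-- A finite multigraph is determined by its multiplicities. Over each unordered pair of vertices
the two sets of edges are finite of equal cardinality, hence in bijection, and these bijections are
glued along the fibres of the map sending an edge to its pair of ends. -/
theorem isIsomorphic_iff {G : Graph α β} {H : Graph γ δ} (hG : E(G).Finite) (hH : E(H).Finite) :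
    G.IsIsomorphic H ↔
      ∃ f : V(G) ≃ V(H), ∀ v w, G.adjCount v w = H.adjCount (f v) (f w) := by
  classical
  have hcount : ∀ f : V(G) ≃ V(H), (∀ v w, G.adjCount v w = H.adjCount (f v) (f w)) ↔
      ∀ v w : V(G), G.mult v w = H.mult (f v) (f w) := by
    intro f
    refine forall_congr' fun v => forall_congr' fun w => ?_
    simp only [adjCount, f.injective.eq_iff]
    split_ifs <;> simp
  simp_rw [hcount]
  refine exists_congr fun f => ⟨fun ⟨g, hg⟩ v w => ?_, fun h => ?_⟩
  · refine Set.ncard_congr (fun e he => g ⟨e, he.edge_mem⟩) (fun e he => (hg _ v w).1 he)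
      (fun e e' he he' h => ?_) fun e he => ?_
    · simpa using g.injective (Subtype.ext h)
    · refine ⟨g.symm ⟨e, he.edge_mem⟩, ?_, by simp⟩
      exact (hg _ v w).2 (by simpa using he)
  · obtain ⟨t, ht⟩ := G.exists_ends
    obtain ⟨t', ht'⟩ := H.exists_ends
    have : Finite E(G) := hG
    have : Finite E(H) := hH
    have fib : ∀ s, Nonempty ({e // t e = s} ≃ {e // t' e = s.map f}) := by
      intro s
      induction s with | _ v w =>
      refine Finite.card_eq.1 ?_
      rw [← mult_eq_card_fiber ht, h, mult_eq_card_fiber ht']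
      rfl
    let F := fun s => (fib s).some
    let g : E(G) ≃ E(H) := (Equiv.sigmaFiberEquiv t).symm.trans
      ((Equiv.sigmaCongr (Equiv.ofBijective (Sym2.map f) ⟨Sym2.map.injective f.injective,
        fun s => ⟨s.map f.symm, by simp [Sym2.map_map]⟩⟩) F).trans (Equiv.sigmaFiberEquiv t'))
    have hg : ∀ e, t' (g e) = (t e).map f := fun e => (F (t e) ⟨e, rfl⟩).2
    refine ⟨g, fun e v w => ?_⟩
    rw [ht, ht', hg, ← Sym2.map_mk, (Sym2.map.injective f.injective).eq_iff]

end Graph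

/-! ### Graphs given by lists of edges -/

/-- The adjacency matrix of `Graph.ofEdges n l`, computed from the list of edges. -/
def edgeCount (l : List (ℕ × ℕ)) (i j : ℕ) : ℕ :=
  (if i = j then 2 else 1) * l.countP fun p => p = (i, j) ∨ p = (j, i)

/-- The edges of `Graph.ofEdges` are positions in the list, so a multiplicity is a number of
positions; this turns it into a computable count. -/
theorem List.ncard_getElem? {α : Type*} (p : α → Bool) (l : List α) :
    {e : ℕ | ∃ x, l[e]? = some x ∧ p x}.ncard = l.countP p := by
  induction l with
  | nil => simp
  | cons y l ih =>
    have h : {e : ℕ | ∃ x, (y :: l)[e]? = some x ∧ p x} =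
        {e | e = 0 ∧ p y} ∪ Nat.succ '' {e : ℕ | ∃ x, l[e]? = some x ∧ p x} := by
      ext e
      cases e <;> simp
    have hfin : {e : ℕ | ∃ x, l[e]? = some x ∧ p x}.Finite := by
      refine (Set.finite_lt_nat l.length).subset ?_
      rintro e ⟨x, hx, -⟩
      exact (List.getElem?_eq_some_iff.1 hx).1
    have h0 : {e : ℕ | e = 0 ∧ p y}.Finite := (Set.finite_singleton 0).subset fun e he => he.1
    rw [h, Set.ncard_union_eq (by
        rw [Set.disjoint_left]
        rintro e ⟨rfl, -⟩ ⟨f, -, hf⟩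
        simp at hf) h0 (hfin.image _),
      Set.ncard_image_of_injective _ Nat.succ_injective, ih, List.countP_cons, add_comm]
    congr 1
    split_ifs with hy <;> simp [hy]

namespace Graph

theorem ofEdges_mult {n : ℕ} {l : List (ℕ × ℕ)} {i j : ℕ} (hi : i < n) (hj : j < n) :
    (ofEdges n l).mult i j = l.countP fun p => p = (i, j) ∨ p = (j, i) := by
  rw [← List.ncard_getElem?, mult]
  congr 1
  ext e
  simp only [ofEdges, Set.mem_ofPred_eq, hi, hj, true_and, decide_eq_true_eq]
  constructor
  · rintro (h | h)
    exacts [⟨_, h, .inl rfl⟩, ⟨_, h, .inr rfl⟩]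
  · rintro ⟨x, h, rfl | rfl⟩
    exacts [.inl h, .inr h]

theorem ofEdges_edgeSet_finite (n : ℕ) (l : List (ℕ × ℕ)) : E(ofEdges n l).Finite := by
  refine (Set.finite_lt_nat l.length).subset fun e he => ?_
  obtain ⟨x, y, -, -, h⟩ := exists_isLink_of_mem_edgeSet he
  rcases h with h | h <;> exact (List.getElem?_eq_some_iff.1 h).1

/-- The vertices of `Graph.ofEdges n l` are `0, …, n - 1`. -/
def ofEdgesVertexEquiv (n : ℕ) (l : List (ℕ × ℕ)) : Fin n ≃ V(ofEdges n l) where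
  toFun i := ⟨i.1, i.2⟩
  invFun v := ⟨v.1, v.2⟩
  left_inv _ := rfl
  right_inv _ := rfl

theorem ofEdges_adjCount {n : ℕ} {l : List (ℕ × ℕ)} (i j : Fin n) :
    (ofEdges n l).adjCount (ofEdgesVertexEquiv n l i) (ofEdgesVertexEquiv n l j) =
      edgeCount l i j := by
  rw [adjCount, edgeCount, ← ofEdges_mult i.2 j.2]
  simp only [(ofEdgesVertexEquiv n l).injective.eq_iff, Fin.ext_iff]
  rfl

theorem ofEdges_rank (n : ℕ) (l : List (ℕ × ℕ)) : (ofEdges n l).rank = n := by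
  rw [rank, ← Nat.card_coe_set_eq, ← Nat.card_congr (ofEdgesVertexEquiv n l), Nat.card_fin]

theorem isIsomorphic_ofEdges_iff {α β : Type*} {G : Graph α β} (hE : E(G).Finite) {n : ℕ}
    {l : List (ℕ × ℕ)} : G.IsIsomorphic (ofEdges n l) ↔ ∃ f : Fin n → V(G), f.Bijective ∧
      ∀ i j, G.adjCount (f i) (f j) = edgeCount l i j := by
  rw [isIsomorphic_iff hE (ofEdges_edgeSet_finite n l)]
  constructor
  · rintro ⟨f, hf⟩
    refine ⟨_, ((ofEdgesVertexEquiv n l).trans f.symm).bijective, fun i j => ?_⟩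
    simp [hf, ofEdges_adjCount]
  · rintro ⟨f, hf, h⟩
    refine ⟨(Equiv.ofBijective f hf).symm.trans (ofEdgesVertexEquiv n l), fun v w => ?_⟩
    obtain ⟨i, rfl⟩ := hf.2 v
    obtain ⟨j, rfl⟩ := hf.2 w
    simp [h, ofEdges_adjCount]

end Graph

namespace HypDiagram

/-- The number of vertices of a diagram. -/
def order : HypDiagram → ℕ
  | overext X => X.order + 1
  | loop _ => 1
  | kronecker _ => 2
  | kroneckerOne _ => 2
  | kroneckerTwo _ => 2
  | hypA11 => 3
  | affA21 => 3
  | affA22 => 3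
  | affA23 => 3
  | hypA21 => 4
  | hypA22 => 4
  | hypA31 => 5
  | star5 => 6

/-- The list of edges of a diagram. -/
def edges : HypDiagram → List (ℕ × ℕ)
  | overext X => (0, X.order) :: X.edges
  | loop n => List.replicate n (0, 0)
  | kronecker n => List.replicate n (0, 1)
  | kroneckerOne n => (0, 0) :: List.replicate n (0, 1)
  | kroneckerTwo n => (0, 0) :: (1, 1) :: List.replicate n (0, 1)
  | hypA11 => [(0, 1), (0, 1), (0, 2), (0, 2)]
  | affA21 => [(0, 1), (0, 1), (1, 2), (2, 0)]
  | affA22 => [(0, 1), (0, 1), (1, 2), (1, 2), (2, 0)]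
  | affA23 => [(0, 1), (0, 1), (1, 2), (1, 2), (2, 0), (2, 0)]
  | hypA21 => [(0, 1), (1, 2), (2, 0), (0, 3), (1, 3)]
  | hypA22 => [(0, 1), (1, 2), (2, 0), (0, 3), (1, 3), (2, 3)]
  | hypA31 => [(0, 1), (1, 2), (2, 3), (3, 0), (0, 4), (2, 4)]
  | star5 => [(0, 1), (0, 2), (0, 3), (0, 4), (0, 5)]

theorem graph_eq_ofEdges (D : HypDiagram) : D.graph = Graph.ofEdges D.order D.edges := by
  cases D <;> rfl

/-- The adjacency matrix of a diagram. -/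
def adj (D : HypDiagram) (i j : Fin D.order) : ℕ := edgeCount D.edges i j

theorem edgeCount_comm (l : List (ℕ × ℕ)) (i j : ℕ) : edgeCount l i j = edgeCount l j i := by
  simp only [edgeCount, eq_comm (a := i), or_comm]

theorem adj_comm (D : HypDiagram) (i j : Fin D.order) : D.adj i j = D.adj j i :=
  edgeCount_comm _ _ _

/-- The matrix `a` is the adjacency matrix of the diagram `D`, up to the order of the vertices. -/
def Realizes {V : Type*} (a : V → V → ℕ) (D : HypDiagram) : Prop :=
  ∃ f : Fin D.order → V, f.Bijective ∧ ∀ i j, a (f i) (f j) = D.adj i j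

theorem isIsomorphic_graph_iff {α β : Type*} {G : Graph α β} (hE : G.edgeSet.Finite)
    {D : HypDiagram} : G.IsIsomorphic D.graph ↔ Realizes G.adjCount D := by
  rw [graph_eq_ofEdges, Graph.isIsomorphic_ofEdges_iff hE]
  rfl

end HypDiagram

/-! ### The listed diagrams are connected and hyperbolic -/

/-- The vector `y k` is superharmonic with support exactly the complement of k, so the form is
nonnegative on vectors vanishing at k. All conditions are inequalities in ℕ without subtraction,
hence decidable for concrete data. -/
theorem isHyperbolicMatrix_of_certificate {n : ℕ} {b : Fin n → Fin n → ℕ}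
    (hb : ∀ i j, b i j = b j i) (x : Fin n → ℕ) (y : Fin n → Fin n → ℕ)
    (hx : ∑ i, x i * (2 * x i) < ∑ i, x i * ∑ j, b i j * x j)
    (hy : ∀ k i, i ≠ k → y k i ≠ 0 ∧ ∑ j, b i j * y k j ≤ 2 * y k i) (hy0 : ∀ k, y k k = 0) :
    IsHyperbolicMatrix b := by
  refine ⟨⟨fun i => x i, ?_⟩, fun z k hz => ?_⟩
  · simp only [cartanForm, mul_sub, Finset.sum_sub_distrib, sub_neg]
    exact_mod_cast hx
  · refine cartanForm_nonneg_of_superharmonic hb (y k) (fun i hi => (hy k i ?_).2) z fun i hi => ?_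
    · rintro rfl
      exact hi (hy0 _)
    · by_contra h
      exact (hy k i fun e => h (e ▸ hz)).1 hi

/-- Every vertex other than k has a neighbour of smaller height, so descent along `h` ends at k. A
set closed under adjacency therefore contains a vertex if and only if it contains k. -/
theorem isConnectedMatrix_of_certificate {n : ℕ} {b : Fin n → Fin n → ℕ}
    (hb : ∀ i j, b i j = b j i) (h : Fin n → ℕ) (k : Fin n)
    (hk : ∀ i, i ≠ k → ∃ j, h j < h i ∧ b i j ≠ 0) : IsConnectedMatrix b := by
  refine ⟨⟨k⟩, fun S ⟨u, hu⟩ hcl => ?_⟩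
  have h1 : ∀ m i, h i = m → (i ∈ S ↔ k ∈ S) := by
    intro m
    induction m using Nat.strong_induction_on with
    | _ m ih =>
      rintro i rfl
      by_cases hik : i = k
      · rw [hik]
      obtain ⟨j, hj, hij⟩ := hk i hik
      rw [← ih _ hj j rfl]
      exact ⟨fun hi => hcl i hi j hij, fun hj => hcl j hj i (hb i j ▸ hij)⟩
  exact Set.eq_univ_of_forall fun i => (h1 _ i rfl).2 ((h1 _ u rfl).1 hu)

/-- Numerical data showing that the graph with edges `l` on `n` vertices is connected and of
hyperbolic type: the distances `h` from the vertex `0`, a vector `x` on which the form is negative,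
and for each vertex a vector in `y` that is superharmonic on the complement of the vertex. -/
def IsHyperbolicCertificate (n : ℕ) (l : List (ℕ × ℕ)) (h x : List ℕ) (y : List (List ℕ)) : Prop :=
  (∀ i : Fin n, i.1 ≠ 0 → ∃ j : Fin n, h.getD j 0 < h.getD i 0 ∧ edgeCount l i j ≠ 0) ∧
  (∑ i : Fin n, x.getD i 0 * (2 * x.getD i 0) <
    ∑ i : Fin n, x.getD i 0 * ∑ j : Fin n, edgeCount l i j * x.getD j 0) ∧
  (∀ k i : Fin n, i ≠ k → (y.getD k []).getD i 0 ≠ 0 ∧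
    ∑ j : Fin n, edgeCount l i j * (y.getD k []).getD j 0 ≤ 2 * (y.getD k []).getD i 0) ∧
  ∀ k : Fin n, (y.getD k []).getD k 0 = 0

instance (n : ℕ) (l : List (ℕ × ℕ)) (h x : List ℕ) (y : List (List ℕ)) :
    Decidable (IsHyperbolicCertificate n l h x y) := by
  unfold IsHyperbolicCertificate
  infer_instance

/-- The adjacency matrix of a diagram is that of a connected graph of hyperbolic type. -/
def HypDiagram.IsConnectedHyperbolic (D : HypDiagram) : Prop :=
  IsConnectedMatrix D.adj ∧ IsHyperbolicMatrix D.adj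

theorem IsHyperbolicCertificate.isConnectedHyperbolic {D : HypDiagram} {h x : List ℕ}
    {y : List (List ℕ)} (hD : 0 < D.order)
    (hc : IsHyperbolicCertificate D.order D.edges h x y) : D.IsConnectedHyperbolic := by
  obtain ⟨h1, h2, h3, h4⟩ := hc
  refine ⟨isConnectedMatrix_of_certificate D.adj_comm (fun i => h.getD i 0) ⟨0, hD⟩
    fun i hi => h1 i fun h => hi (Fin.ext h), ?_⟩
  exact isHyperbolicMatrix_of_certificate D.adj_comm (fun i => x.getD i 0)
    (fun k i => (y.getD k []).getD i 0) h2 h3 h4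

namespace HypDiagram

/-- In this and the other overextended certificates the last row of `y` is the radical vector of the
extended diagram that remains when ∞ is deleted. Here `x` is twice that vector plus the unit vector
at ∞, as in `exists_cartanForm_neg_of_ne_univ`; some of the later diagrams use a different `x`. -/
theorem isConnectedHyperbolic_overextA1 : (overext (.A 1)).IsConnectedHyperbolic :=
  IsHyperbolicCertificate.isConnectedHyperbolic (h := [0, 1, 1])
    (x := [2, 2, 1])
    (y := [[0, 1, 1], [1, 0, 1], [1, 1, 0]])
    (by decide) (by decide +kernel)

theorem isConnectedHyperbolic_overextA2 : (overext (.A 2)).IsConnectedHyperbolic :=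
  IsHyperbolicCertificate.isConnectedHyperbolic (h := [0, 1, 1, 1])
    (x := [2, 2, 2, 1])
    (y := [[0, 1, 1, 1], [1, 0, 1, 1], [1, 1, 0, 1], [1, 1, 1, 0]])
    (by decide) (by decide +kernel)

theorem isConnectedHyperbolic_overextA3 : (overext (.A 3)).IsConnectedHyperbolic :=
  IsHyperbolicCertificate.isConnectedHyperbolic (h := [0, 1, 2, 1, 1])
    (x := [2, 2, 2, 2, 1])
    (y := [[0, 1, 1, 1, 1], [1, 0, 1, 1, 1], [2, 1, 0, 1, 1], [1, 1, 1, 0, 1], [1, 1, 1, 1, 0]])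
    (by decide) (by decide +kernel)

theorem isConnectedHyperbolic_overextA4 : (overext (.A 4)).IsConnectedHyperbolic :=
  IsHyperbolicCertificate.isConnectedHyperbolic (h := [0, 1, 2, 2, 1, 1])
    (x := [2, 2, 2, 2, 2, 1])
    (y := [[0, 1, 1, 1, 1, 1], [1, 0, 1, 1, 1, 1], [2, 1, 0, 1, 2, 1], [2, 2, 1, 0, 1, 1],
      [1, 1, 1, 1, 0, 1], [1, 1, 1, 1, 1, 0]])
    (by decide) (by decide +kernel)

theorem isConnectedHyperbolic_overextA5 : (overext (.A 5)).IsConnectedHyperbolic :=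
  IsHyperbolicCertificate.isConnectedHyperbolic (h := [0, 1, 2, 3, 2, 1, 1])
    (x := [2, 2, 2, 2, 2, 2, 1])
    (y := [[0, 1, 1, 1, 1, 1, 1], [1, 0, 1, 1, 1, 1, 1], [2, 1, 0, 1, 2, 2, 1],
      [3, 2, 1, 0, 1, 2, 2], [2, 2, 2, 1, 0, 1, 1], [1, 1, 1, 1, 1, 0, 1], [1, 1, 1, 1, 1, 1, 0]])
    (by decide) (by decide +kernel)

theorem isConnectedHyperbolic_overextA6 : (overext (.A 6)).IsConnectedHyperbolic :=
  IsHyperbolicCertificate.isConnectedHyperbolic (h := [0, 1, 2, 3, 3, 2, 1, 1])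
    (x := [4, 3, 2, 1, 1, 2, 3, 2])
    (y := [[0, 1, 1, 1, 1, 1, 1, 1], [1, 0, 1, 1, 1, 1, 1, 1], [2, 1, 0, 1, 2, 2, 2, 1],
      [4, 3, 2, 0, 1, 2, 3, 2], [4, 3, 2, 1, 0, 2, 3, 2], [2, 2, 2, 2, 1, 0, 1, 1],
      [1, 1, 1, 1, 1, 1, 0, 1], [1, 1, 1, 1, 1, 1, 1, 0]])
    (by decide) (by decide +kernel)

theorem isConnectedHyperbolic_overextA7 : (overext (.A 7)).IsConnectedHyperbolic :=
  IsHyperbolicCertificate.isConnectedHyperbolic (h := [0, 1, 2, 3, 4, 3, 2, 1, 1])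
    (x := [6, 4, 2, 1, 2, 3, 4, 5, 3])
    (y := [[0, 1, 1, 1, 1, 1, 1, 1, 1], [1, 0, 1, 1, 1, 1, 1, 1, 1], [2, 1, 0, 1, 2, 2, 2, 2, 1],
      [6, 4, 2, 0, 2, 3, 4, 5, 3], [4, 3, 2, 1, 0, 1, 2, 3, 2], [6, 5, 4, 3, 2, 0, 2, 4, 3],
      [2, 2, 2, 2, 2, 1, 0, 1, 1], [1, 1, 1, 1, 1, 1, 1, 0, 1], [1, 1, 1, 1, 1, 1, 1, 1, 0]])
    (by decide) (by decide +kernel)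

theorem isConnectedHyperbolic_overextD4 : (overext (.D 4)).IsConnectedHyperbolic :=
  IsHyperbolicCertificate.isConnectedHyperbolic (h := [0, 2, 1, 2, 2, 1])
    (x := [2, 2, 4, 2, 2, 1])
    (y := [[0, 1, 2, 1, 1, 1], [2, 0, 2, 1, 1, 1], [1, 1, 0, 1, 1, 1], [2, 1, 2, 0, 1, 1],
      [2, 1, 2, 1, 0, 1], [1, 1, 2, 1, 1, 0]])
    (by decide) (by decide +kernel)

theorem isConnectedHyperbolic_overextD5 : (overext (.D 5)).IsConnectedHyperbolic :=
  IsHyperbolicCertificate.isConnectedHyperbolic (h := [0, 2, 1, 2, 3, 3, 1])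
    (x := [2, 2, 4, 4, 2, 2, 1])
    (y := [[0, 1, 2, 2, 1, 1, 1], [2, 0, 2, 2, 1, 1, 1], [1, 1, 0, 1, 1, 1, 1],
      [1, 1, 1, 0, 1, 1, 1], [2, 2, 3, 2, 0, 1, 1], [2, 2, 3, 2, 1, 0, 1], [1, 1, 2, 2, 1, 1, 0]])
    (by decide) (by decide +kernel)

theorem isConnectedHyperbolic_overextD6 : (overext (.D 6)).IsConnectedHyperbolic :=
  IsHyperbolicCertificate.isConnectedHyperbolic (h := [0, 2, 1, 2, 3, 4, 4, 1])
    (x := [2, 2, 4, 4, 4, 2, 2, 1])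
    (y := [[0, 1, 2, 2, 2, 1, 1, 1], [2, 0, 2, 2, 2, 1, 1, 1], [1, 1, 0, 1, 2, 1, 1, 1],
      [1, 1, 1, 0, 1, 1, 1, 1], [2, 1, 2, 1, 0, 1, 1, 1], [3, 2, 4, 3, 2, 0, 1, 2],
      [3, 2, 4, 3, 2, 1, 0, 2], [1, 1, 2, 2, 2, 1, 1, 0]])
    (by decide) (by decide +kernel)

theorem isConnectedHyperbolic_overextD7 : (overext (.D 7)).IsConnectedHyperbolic :=
  IsHyperbolicCertificate.isConnectedHyperbolic (h := [0, 2, 1, 2, 3, 4, 5, 5, 1])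
    (x := [4, 3, 6, 5, 4, 3, 1, 2, 2])
    (y := [[0, 1, 2, 2, 2, 2, 1, 1, 1], [2, 0, 2, 2, 2, 2, 1, 1, 1], [1, 1, 0, 1, 2, 2, 1, 1, 1],
      [1, 1, 1, 0, 1, 2, 1, 1, 1], [2, 1, 2, 1, 0, 1, 1, 1, 1], [2, 2, 3, 2, 1, 0, 1, 1, 1],
      [4, 3, 6, 5, 4, 3, 0, 2, 2], [4, 3, 6, 5, 4, 3, 2, 0, 2], [1, 1, 2, 2, 2, 2, 1, 1, 0]])
    (by decide) (by decide +kernel)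

theorem isConnectedHyperbolic_overextD8 : (overext (.D 8)).IsConnectedHyperbolic :=
  IsHyperbolicCertificate.isConnectedHyperbolic (h := [0, 2, 1, 2, 3, 4, 5, 6, 6, 1])
    (x := [4, 3, 6, 5, 4, 3, 2, 1, 1, 2])
    (y := [[0, 1, 2, 2, 2, 2, 2, 1, 1, 1], [2, 0, 2, 2, 2, 2, 2, 1, 1, 1],
      [1, 1, 0, 1, 2, 2, 2, 1, 1, 1], [1, 1, 1, 0, 1, 2, 2, 1, 1, 1],
      [2, 1, 2, 1, 0, 1, 2, 1, 1, 1], [2, 2, 3, 2, 1, 0, 1, 1, 1, 1],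
      [3, 2, 4, 3, 2, 1, 0, 1, 1, 2], [4, 3, 6, 5, 4, 3, 2, 0, 1, 2],
      [4, 3, 6, 5, 4, 3, 2, 1, 0, 2], [1, 1, 2, 2, 2, 2, 2, 1, 1, 0]])
    (by decide) (by decide +kernel)

theorem isConnectedHyperbolic_overextE6 : (overext .E6).IsConnectedHyperbolic :=
  IsHyperbolicCertificate.isConnectedHyperbolic (h := [0, 4, 1, 3, 2, 3, 4, 1])
    (x := [2, 2, 4, 4, 6, 4, 2, 1])
    (y := [[0, 1, 2, 2, 3, 2, 1, 1], [2, 0, 3, 2, 4, 3, 2, 1], [1, 1, 0, 1, 1, 1, 1, 1],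
      [1, 1, 1, 0, 1, 1, 1, 1], [1, 1, 1, 1, 0, 1, 1, 1], [1, 1, 1, 1, 1, 0, 1, 1],
      [2, 2, 3, 3, 4, 2, 0, 1], [1, 1, 2, 2, 3, 2, 1, 0]])
    (by decide) (by decide +kernel)

theorem isConnectedHyperbolic_overextE7 : (overext .E7).IsConnectedHyperbolic :=
  IsHyperbolicCertificate.isConnectedHyperbolic (h := [0, 1, 4, 2, 3, 4, 5, 6, 1])
    (x := [2, 4, 4, 6, 8, 6, 4, 2, 1])
    (y := [[0, 2, 2, 3, 4, 3, 2, 1, 1], [1, 0, 1, 1, 2, 2, 2, 1, 1], [1, 1, 0, 1, 1, 1, 1, 1, 1],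
      [1, 1, 1, 0, 1, 1, 1, 1, 1], [1, 1, 1, 1, 0, 1, 1, 1, 1], [1, 1, 1, 1, 1, 0, 1, 1, 1],
      [2, 2, 1, 2, 2, 1, 0, 1, 1], [3, 4, 3, 5, 6, 4, 2, 0, 2], [1, 2, 2, 3, 4, 3, 2, 1, 0]])
    (by decide) (by decide +kernel)

theorem isConnectedHyperbolic_overextE8 : (overext .E8).IsConnectedHyperbolic :=
  IsHyperbolicCertificate.isConnectedHyperbolic (h := [0, 7, 6, 6, 5, 4, 3, 2, 1, 1])
    (x := [2, 4, 6, 8, 12, 10, 8, 6, 4, 1])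
    (y := [[0, 2, 3, 4, 6, 5, 4, 3, 2, 1], [2, 0, 1, 1, 2, 2, 2, 2, 2, 1],
      [1, 1, 0, 1, 1, 1, 1, 1, 1, 1], [1, 1, 1, 0, 1, 1, 1, 1, 1, 1],
      [1, 1, 1, 1, 0, 1, 1, 1, 1, 1], [1, 1, 1, 1, 1, 0, 1, 1, 1, 1],
      [1, 1, 1, 2, 2, 1, 0, 1, 1, 1], [1, 1, 2, 2, 3, 2, 1, 0, 1, 1],
      [1, 2, 2, 3, 4, 3, 2, 1, 0, 1], [1, 2, 3, 4, 6, 5, 4, 3, 2, 0]])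
    (by decide) (by decide +kernel)

theorem isConnectedHyperbolic_hypA11 : (hypA11).IsConnectedHyperbolic :=
  IsHyperbolicCertificate.isConnectedHyperbolic (h := [0, 1, 1])
    (x := [1, 1, 1])
    (y := [[0, 1, 1], [1, 0, 1], [1, 1, 0]])
    (by decide) (by decide +kernel)

theorem isConnectedHyperbolic_affA21 : (affA21).IsConnectedHyperbolic :=
  IsHyperbolicCertificate.isConnectedHyperbolic (h := [0, 1, 1])
    (x := [1, 1, 1])
    (y := [[0, 1, 1], [1, 0, 1], [1, 1, 0]])
    (by decide) (by decide +kernel)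

theorem isConnectedHyperbolic_affA22 : (affA22).IsConnectedHyperbolic :=
  IsHyperbolicCertificate.isConnectedHyperbolic (h := [0, 1, 1])
    (x := [1, 1, 1])
    (y := [[0, 1, 1], [1, 0, 1], [1, 1, 0]])
    (by decide) (by decide +kernel)

theorem isConnectedHyperbolic_affA23 : (affA23).IsConnectedHyperbolic :=
  IsHyperbolicCertificate.isConnectedHyperbolic (h := [0, 1, 1])
    (x := [1, 1, 1])
    (y := [[0, 1, 1], [1, 0, 1], [1, 1, 0]])
    (by decide) (by decide +kernel)

theorem isConnectedHyperbolic_hypA21 : (hypA21).IsConnectedHyperbolic :=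
  IsHyperbolicCertificate.isConnectedHyperbolic (h := [0, 1, 1, 1])
    (x := [1, 1, 1, 1])
    (y := [[0, 1, 1, 1], [1, 0, 1, 1], [1, 1, 0, 1], [1, 1, 1, 0]])
    (by decide) (by decide +kernel)

theorem isConnectedHyperbolic_hypA22 : (hypA22).IsConnectedHyperbolic :=
  IsHyperbolicCertificate.isConnectedHyperbolic (h := [0, 1, 1, 1])
    (x := [1, 1, 1, 1])
    (y := [[0, 1, 1, 1], [1, 0, 1, 1], [1, 1, 0, 1], [1, 1, 1, 0]])
    (by decide) (by decide +kernel)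

theorem isConnectedHyperbolic_hypA31 : (hypA31).IsConnectedHyperbolic :=
  IsHyperbolicCertificate.isConnectedHyperbolic (h := [0, 1, 2, 1, 1])
    (x := [1, 1, 2, 1, 1])
    (y := [[0, 1, 2, 1, 1], [1, 0, 1, 1, 1], [2, 1, 0, 1, 1], [1, 1, 1, 0, 1], [1, 1, 1, 1, 0]])
    (by decide) (by decide +kernel)

theorem isConnectedHyperbolic_star5 : (star5).IsConnectedHyperbolic :=
  IsHyperbolicCertificate.isConnectedHyperbolic (h := [0, 1, 1, 1, 1, 1])
    (x := [2, 1, 1, 1, 1, 1])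
    (y := [[0, 1, 1, 1, 1, 1], [2, 0, 1, 1, 1, 1], [2, 1, 0, 1, 1, 1], [2, 1, 1, 0, 1, 1],
      [2, 1, 1, 1, 0, 1], [2, 1, 1, 1, 1, 0]])
    (by decide) (by decide +kernel)

theorem kronecker_adj (n : ℕ) : (kronecker n).adj = ![![0, n], ![n, 0]] := by
  ext i j
  change edgeCount _ _ _ = _
  fin_cases i <;> fin_cases j <;> simp [edgeCount, edges, List.countP_replicate] <;> rfl

theorem kroneckerOne_adj (n : ℕ) : (kroneckerOne n).adj = ![![2, n], ![n, 0]] := by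
  ext i j
  change edgeCount _ _ _ = _
  fin_cases i <;> fin_cases j <;> simp [edgeCount, edges, List.countP_replicate] <;> rfl

theorem kroneckerTwo_adj (n : ℕ) : (kroneckerTwo n).adj = ![![2, n], ![n, 2]] := by
  ext i j
  change edgeCount _ _ _ = _
  fin_cases i <;> fin_cases j <;> simp [edgeCount, edges, List.countP_replicate] <;> rfl

theorem loop_adj (n : ℕ) : (loop n).adj = ![![2 * n]] := by
  ext i j
  change edgeCount _ _ _ = _
  fin_cases i
  fin_cases j
  simp [edgeCount, edges, List.countP_replicate]
  rfl

theorem isConnectedHyperbolic_loop {n : ℕ} (hn : 2 ≤ n) : (loop n).IsConnectedHyperbolic := by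
  rw [IsConnectedHyperbolic, loop_adj]
  constructor
  · refine isConnectedMatrix_of_certificate (n := 1) (fun i j => ?_) ![0] 0
      fun i hi => absurd (Subsingleton.elim i 0) hi
    fin_cases i; fin_cases j; rfl
  · refine isHyperbolicMatrix_of_certificate (n := 1) (fun i j => ?_) ![1] 0 ?_
      (fun i j h => absurd (Subsingleton.elim j i) h) fun _ => rfl
    · fin_cases i; fin_cases j; rfl
    · simp
      omega

theorem isConnectedMatrix_of_ne_zero {p q n : ℕ} (hn : n ≠ 0) :
    IsConnectedMatrix (![![p, n], ![n, q]] : Fin 2 → Fin 2 → ℕ) := by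
  refine isConnectedMatrix_of_certificate (n := 2) (fun i j => ?_) ![0, 1] 0 fun i hi => ⟨0, ?_⟩
  · fin_cases i <;> fin_cases j <;> rfl
  · obtain rfl : i = 1 := by omega
    simp [hn]

/-- The proper nonempty subgraphs are single vertices, for which the diagonal bounds suffice; only
wildness needs the vector (x, y). -/
theorem isHyperbolicMatrix_of_le {p q n x y : ℕ} (hp : p ≤ 2) (hq : q ≤ 2)
    (h : x * (2 * x) + y * (2 * y) < x * (p * x + n * y) + y * (n * x + q * y)) :
    IsHyperbolicMatrix (![![p, n], ![n, q]] : Fin 2 → Fin 2 → ℕ) := by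
  refine isHyperbolicMatrix_of_certificate (n := 2) (fun i j => ?_) ![x, y] ![![0, 1], ![1, 0]]
    (by simpa using h) (fun i j hij => ?_) fun i => ?_
  · fin_cases i <;> fin_cases j <;> rfl
  · fin_cases i <;> fin_cases j <;> simp_all
  · fin_cases i <;> rfl

theorem isConnectedHyperbolic_kronecker {n : ℕ} (hn : 3 ≤ n) :
    (kronecker n).IsConnectedHyperbolic := by
  rw [IsConnectedHyperbolic, kronecker_adj]
  exact ⟨isConnectedMatrix_of_ne_zero (by omega),
    isHyperbolicMatrix_of_le (x := 1) (y := 1) (by simp) (by simp) (by omega)⟩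

theorem isConnectedHyperbolic_kroneckerOne {n : ℕ} (hn : 1 ≤ n) :
    (kroneckerOne n).IsConnectedHyperbolic := by
  rw [IsConnectedHyperbolic, kroneckerOne_adj]
  exact ⟨isConnectedMatrix_of_ne_zero (by omega),
    -- The vector (1, 1) does not suffice when n = 1, since the form vanishes there; at (2, 1) the
    -- form is 2 − 4n.
    isHyperbolicMatrix_of_le (x := 2) (y := 1) (by simp) (by simp) (by omega)⟩

theorem isConnectedHyperbolic_kroneckerTwo {n : ℕ} (hn : 1 ≤ n) :
    (kroneckerTwo n).IsConnectedHyperbolic := by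
  rw [IsConnectedHyperbolic, kroneckerTwo_adj]
  exact ⟨isConnectedMatrix_of_ne_zero (by omega),
    isHyperbolicMatrix_of_le (x := 1) (y := 1) (by simp) (by simp) (by omega)⟩

theorem IsListed.isConnectedHyperbolic : ∀ {D : HypDiagram}, D.IsListed → D.IsConnectedHyperbolic
  | overext (.A n), h => by
    obtain ⟨h1, h2⟩ := h
    interval_cases n
    exacts [isConnectedHyperbolic_overextA1, isConnectedHyperbolic_overextA2,
      isConnectedHyperbolic_overextA3, isConnectedHyperbolic_overextA4,
      isConnectedHyperbolic_overextA5, isConnectedHyperbolic_overextA6,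
      isConnectedHyperbolic_overextA7]
  | overext (.D n), h => by
    obtain ⟨h1, h2⟩ := h
    interval_cases n
    exacts [isConnectedHyperbolic_overextD4, isConnectedHyperbolic_overextD5,
      isConnectedHyperbolic_overextD6, isConnectedHyperbolic_overextD7,
      isConnectedHyperbolic_overextD8]
  | overext .E6, _ => isConnectedHyperbolic_overextE6
  | overext .E7, _ => isConnectedHyperbolic_overextE7
  | overext .E8, _ => isConnectedHyperbolic_overextE8
  | loop _, h => isConnectedHyperbolic_loop h
  | kronecker _, h => isConnectedHyperbolic_kronecker h
  | kroneckerOne _, h => isConnectedHyperbolic_kroneckerOne h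
  | kroneckerTwo _, h => isConnectedHyperbolic_kroneckerTwo h
  | hypA11, _ => isConnectedHyperbolic_hypA11
  | affA21, _ => isConnectedHyperbolic_affA21
  | affA22, _ => isConnectedHyperbolic_affA22
  | affA23, _ => isConnectedHyperbolic_affA23
  | hypA21, _ => isConnectedHyperbolic_hypA21
  | hypA22, _ => isConnectedHyperbolic_hypA22
  | hypA31, _ => isConnectedHyperbolic_hypA31
  | star5, _ => isConnectedHyperbolic_star5

end HypDiagram

open HypDiagram

/-! ### Graphs with loops or multiple edges -/

section Classification

variable {V : Type*}

/-- The enumeration `f` comes from the way the vertices were found in the graph; `σ` sends a label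
of the diagram to the corresponding index of `f`. Realization becomes a comparison of two explicit
matrices. -/
theorem realizes_of_bijective {a : V → V → ℕ} {n : ℕ} {f : Fin n → V} (hf : f.Bijective)
    {b : Fin n → Fin n → ℕ} (hb : ∀ i j, a (f i) (f j) = b i j) (D : HypDiagram)
    (hD : D.order = n) (σ : Fin n → Fin n) (hσ : ∀ i j, σ i = σ j → i = j)
    (h : ∀ i j, b (σ i) (σ j) = edgeCount D.edges i j) : Realizes a D := by
  subst hD
  exact ⟨f ∘ σ, hf.comp (Finite.injective_iff_bijective.1 fun i j => hσ i j),
    fun i j => by rw [adj, ← h, ← hb]; rfl⟩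

variable [Fintype V]

theorem IsHyperbolicMatrix.nonneg_of_injective {a : V → V → ℕ} (hh : IsHyperbolicMatrix a) {n : ℕ}
    {f : Fin n → V} (hf : f.Injective) {w : V} (hw : w ∉ Set.range f) (y : Fin n → ℝ) :
    0 ≤ cartanForm (fun i j => a (f i) (f j)) y := by
  have := cartanForm_comp_of_injective (a := fun i j => a (f i) (f j)) hf (fun _ _ => rfl)
    (Function.extend f y 0) fun w hw => Function.extend_apply' _ _ _ hw
  rw [Function.extend_comp hf] at this
  rw [this]
  exact hh.2 _ w (Function.extend_apply' _ _ _ hw)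

theorem IsHyperbolicMatrix.diag_le_two {a : V → V → ℕ} (hh : IsHyperbolicMatrix a) {v w : V}
    (h : v ≠ w) : a v v ≤ 2 := by
  have := hh.nonneg_of_injective (f := ![v]) (Function.injective_of_subsingleton _) (w := w)
    (by simpa using h.symm) 1
  simp only [cartanForm, Finset.univ_unique, Finset.sum_singleton] at this
  simp at this
  exact_mod_cast this

/-- The full subgraph on u, v avoids w, so the form, which is 4 − 2 a_{uv} at (1, 1), is
nonnegative. -/
theorem IsHyperbolicMatrix.le_two {a : V → V → ℕ} (ha : ∀ v w, a v w = a w v)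
    (hh : IsHyperbolicMatrix a) (ha0 : ∀ v, a v v = 0)
    {u v w : V} (huv : u ≠ v) (huw : u ≠ w) (hvw : v ≠ w) : a u v ≤ 2 := by
  have := hh.nonneg_of_injective (f := ![u, v]) (w := w)
    (by intro i j; fin_cases i <;> fin_cases j <;> simp [huv, huv.symm])
    (by simp [huw, hvw, eq_comm]) 1
  simp [cartanForm, ha0, ha v u] at this
  have h : (a u v : ℝ) ≤ 2 := by linarith
  exact_mod_cast h

/-- A vertex with a loop is an affine subgraph with δ = 1, so at most one other vertex exists. With
a second vertex, both diagonal entries are at most 2 and even, which leaves only the two families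
with loops on two vertices; alone, the vertex must carry at least two loops by wildness. -/
theorem exists_realizes_of_loop {a : V → V → ℕ} (ha : ∀ v w, a v w = a w v)
    (hd : ∀ v, Even (a v v)) (hc : IsConnectedMatrix a) (hh : IsHyperbolicMatrix a) {v : V}
    (hv : a v v ≠ 0) : ∃ D : HypDiagram, D.IsListed ∧ Realizes a D := by
  have h2 : 2 ≤ a v v := by
    obtain ⟨k, hk⟩ := hd v
    omega
  rcases card_le_of_embedding ha hc hh ![v] (Function.injective_of_subsingleton _)
    (fun _ _ => 2) (fun i j => by simpa using h2) 1 one_pos (by simp) (by simp)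
    with h | ⟨w, hw, ⟨i, hi⟩, hall⟩
  · have hbij : Function.Bijective ![v] :=
      ⟨Function.injective_of_subsingleton _, Set.range_eq_univ.1 h⟩
    obtain ⟨k, hk⟩ := hd v
    have hk2 : 2 ≤ k := by
      by_contra! hlt
      obtain ⟨x, hx⟩ := hh.1
      refine absurd (cartanForm_nonneg_of_bijective ha _ hbij 1 (by simp) (fun i => ?_) x)
        (not_le.2 hx)
      simp
      omega
    refine ⟨loop k, hk2, realizes_of_bijective hbij (b := ![![2 * k]]) (fun i j => ?_) _ rfl id
      (fun _ _ => id) (congrFun₂ (loop_adj _).symm)⟩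
    simp [hk, two_mul]
  · have hwv : w ≠ v := by simpa using hw
    have hbij : Function.Bijective ![v, w] := by
      refine ⟨?_, fun z => ?_⟩
      · intro i j
        fin_cases i <;> fin_cases j <;> simp [hwv, hwv.symm]
      · rcases hall z with rfl | ⟨_, rfl⟩
        exacts [⟨1, rfl⟩, ⟨0, by simp⟩]
    have hv2 : a v v = 2 := le_antisymm (hh.diag_le_two hwv.symm) h2
    have hvw : a v w ≠ 0 := by simpa using hi
    have hw2 : a w w = 0 ∨ a w w = 2 := by
      have := hh.diag_le_two hwv
      obtain ⟨k, hk⟩ := hd w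
      omega
    rcases hw2 with hw2 | hw2
    · refine ⟨kroneckerOne (a v w), Nat.one_le_iff_ne_zero.2 hvw, realizes_of_bijective hbij
        (b := ![![2, a v w], ![a v w, 0]]) (fun i j => ?_) _ rfl id (fun _ _ => id)
        (congrFun₂ (kroneckerOne_adj _).symm)⟩
      fin_cases i <;> fin_cases j <;> simp [hv2, hw2, ha w v]
    · refine ⟨kroneckerTwo (a v w), Nat.one_le_iff_ne_zero.2 hvw, realizes_of_bijective hbij
        (b := ![![2, a v w], ![a v w, 2]]) (fun i j => ?_) _ rfl id (fun _ _ => id)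
        (congrFun₂ (kroneckerTwo_adj _).symm)⟩
      fin_cases i <;> fin_cases j <;> simp [hv2, hw2, ha w v]

/-- A double edge is an affine subgraph, so at most one vertex w lies outside {u, v}. If there is
one, all three multiplicities are at most 2 by `IsHyperbolicMatrix.le_two`. -/
theorem exists_realizes_of_multiple_edge {a : V → V → ℕ} (ha : ∀ v w, a v w = a w v)
    (ha0 : ∀ v, a v v = 0) (hc : IsConnectedMatrix a) (hh : IsHyperbolicMatrix a) {u v : V}
    (huv : 2 ≤ a u v) : ∃ D : HypDiagram, D.IsListed ∧ Realizes a D := by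
  have hne : u ≠ v := by
    rintro rfl
    simp [ha0] at huv
  have hinj : Function.Injective ![u, v] := by
    intro i j
    fin_cases i <;> fin_cases j <;> simp [hne, hne.symm]
  rcases card_le_of_embedding ha hc hh ![u, v] hinj
    ![![0, 2], ![2, 0]] (fun i j => by fin_cases i <;> fin_cases j <;> simp [huv, ha v u]) 1
    two_pos (by simp) (by decide) with h | ⟨w, hw, ⟨i, hi⟩, hall⟩
  · have hbij : Function.Bijective ![u, v] := ⟨hinj, Set.range_eq_univ.1 h⟩
    have hk2 : 3 ≤ a u v := by
      by_contra! hlt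
      obtain ⟨x, hx⟩ := hh.1
      refine absurd (cartanForm_nonneg_of_bijective ha _ hbij 1 (by simp) (fun i => ?_) x)
        (not_le.2 hx)
      fin_cases i <;> simp [ha0, ha v u] <;> omega
    refine ⟨kronecker (a u v), hk2, realizes_of_bijective hbij
      (b := ![![0, a u v], ![a u v, 0]]) (fun i j => ?_) _ rfl id (fun _ _ => id)
      (congrFun₂ (kronecker_adj _).symm)⟩
    fin_cases i <;> fin_cases j <;> simp [ha0, ha v u]
  · obtain ⟨hwu, hwv⟩ : u ≠ w ∧ v ≠ w := by simpa [eq_comm, and_comm] using hw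
    have hbij : Function.Bijective ![u, v, w] := by
      refine ⟨?_, fun z => ?_⟩
      · intro i j
        fin_cases i <;> fin_cases j <;> simp [hne, hne.symm, hwu, hwu.symm, hwv, hwv.symm]
      · rcases hall z with rfl | ⟨i, rfl⟩
        · exact ⟨2, rfl⟩
        · fin_cases i
          exacts [⟨0, rfl⟩, ⟨1, rfl⟩]
    have h1 := hh.le_two ha ha0 hne hwu hwv
    have h2 := hh.le_two ha ha0 hwu hne hwv.symm
    have h3 := hh.le_two ha ha0 hwv hne.symm hwu.symm
    have h12 : a u v = 2 := by omega
    have hpq : a u w ≠ 0 ∨ a v w ≠ 0 := by fin_cases i <;> simp_all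
    have hb : ∀ i j, a (![u, v, w] i) (![u, v, w] j) =
        (![![0, 2, a u w], ![2, 0, a v w], ![a u w, a v w, 0]] : Fin 3 → Fin 3 → ℕ) i j := by
      intro i j
      fin_cases i <;> fin_cases j <;> simp [ha0, h12, ha w u, ha w v, ha v u]
    have real := fun D hD => realizes_of_bijective hbij hb D hD
    generalize a u w = p at *
    generalize a v w = q at *
    -- The nine pairs (p, q) of multiplicities from w, in lexicographic order; (0, 0) contradicts
    -- connectedness.
    interval_cases p <;> interval_cases q
    · simp at hpq
    · exact ⟨overext (.A 1), by simp [IsListed], real _ rfl ![1, 0, 2] (by decide) (by decide +kernel)⟩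
    · exact ⟨hypA11, trivial, real _ rfl ![1, 0, 2] (by decide) (by decide +kernel)⟩
    · exact ⟨overext (.A 1), by simp [IsListed], real _ rfl ![0, 1, 2] (by decide) (by decide +kernel)⟩
    · exact ⟨affA21, trivial, real _ rfl ![0, 1, 2] (by decide) (by decide +kernel)⟩
    · exact ⟨affA22, trivial, real _ rfl ![0, 1, 2] (by decide) (by decide +kernel)⟩
    · exact ⟨hypA11, trivial, real _ rfl ![0, 1, 2] (by decide) (by decide +kernel)⟩
    · exact ⟨affA22, trivial, real _ rfl ![1, 0, 2] (by decide) (by decide +kernel)⟩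
    · exact ⟨affA23, trivial, real _ rfl ![0, 1, 2] (by decide) (by decide +kernel)⟩

end Classification

/-! ### Trees spanned by lists of vertices -/

section Trees

variable {V : Type*} {Γ : SimpleGraph V}

open Classical in
/-- The adjacency matrix of a simple graph, with entries in `ℕ`. -/
noncomputable def SimpleGraph.adjNat (Γ : SimpleGraph V) (v w : V) : ℕ := if Γ.Adj v w then 1 else 0

theorem SimpleGraph.adjNat_comm (Γ : SimpleGraph V) (v w : V) : Γ.adjNat v w = Γ.adjNat w v := by
  by_cases h : Γ.Adj v w
  · rw [adjNat, adjNat, if_pos h, if_pos h.symm]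
  · rw [adjNat, adjNat, if_neg h, if_neg fun h' => h h'.symm]

theorem SimpleGraph.adjNat_ne_zero {v w : V} : Γ.adjNat v w ≠ 0 ↔ Γ.Adj v w := by
  simp [adjNat]

/-- `IsTreeIn Γ p L`: the distinct vertices in the list `L` span a tree in `Γ` (not necessarily
full), where the vertex with index `i + 1` is attached to that with index `p[i]`. -/
inductive IsTreeIn (Γ : SimpleGraph V) : List ℕ → List V → Prop
  | single (v : V) : IsTreeIn Γ [] [v]
  | snoc {p : List ℕ} {L : List V} (h : IsTreeIn Γ p L) (k : ℕ) {u v : V} (hk : L[k]? = some u)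
      (huv : Γ.Adj u v) (hv : v ∉ L) : IsTreeIn Γ (p ++ [k]) (L ++ [v])

/-- The adjacency matrix of the tree in which the vertex `i + 1` is attached to `p[i]`. -/
def treeAdj (p : List ℕ) (i j : ℕ) : ℕ :=
  if (0 < i ∧ p[i - 1]? = some j) ∨ (0 < j ∧ p[j - 1]? = some i) then 1 else 0

theorem treeAdj_comm (p : List ℕ) (i j : ℕ) : treeAdj p i j = treeAdj p j i := by
  simp only [treeAdj, or_comm]

namespace IsTreeIn

variable {p : List ℕ} {L : List V}

theorem length_eq (h : IsTreeIn Γ p L) : L.length = p.length + 1 := by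
  induction h <;> simp_all

theorem nodup (h : IsTreeIn Γ p L) : L.Nodup := by
  induction h with
  | single => simp
  | snoc _ _ _ _ hv ih => exact List.concat_eq_append ▸ ih.concat hv

theorem parent_lt (h : IsTreeIn Γ p L) {i k : ℕ} (hk : p[i]? = some k) : k < L.length := by
  induction h generalizing i k with
  | single => simp at hk
  | @snoc p L h m u' v' hm huv _ ih =>
    have hml : m < L.length := (List.getElem?_eq_some_iff.1 hm).1
    rw [List.length_append]
    rcases lt_or_ge i p.length with hi | hi
    · rw [List.getElem?_append_left hi] at hk
      exact Nat.lt_add_right _ (ih hk)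
    · rw [List.getElem?_append_right hi, List.getElem?_singleton] at hk
      split_ifs at hk
      simp only [Option.some.injEq] at hk
      omega

theorem adj_of_parent (h : IsTreeIn Γ p L) {i k : ℕ} (hk : p[i]? = some k) {u v : V}
    (hu : L[k]? = some u) (hv : L[i + 1]? = some v) : Γ.Adj u v := by
  induction h generalizing i k u v with
  | single => simp at hk
  | @snoc p L h m u' v' hm huv _ ih =>
    have hlen := h.length_eq
    have hml : m < L.length := (List.getElem?_eq_some_iff.1 hm).1
    rcases lt_trichotomy i p.length with hi | hi | hi
    · rw [List.getElem?_append_left hi] at hk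
      rw [List.getElem?_append_left (by omega)] at hv
      have hkl : k < L.length := h.parent_lt hk
      rw [List.getElem?_append_left hkl] at hu
      exact ih hk hu hv
    · subst hi
      simp only [List.getElem?_concat_length, Option.some.injEq] at hk
      subst hk
      rw [List.getElem?_append_left hml, hm] at hu
      rw [← hlen, List.getElem?_concat_length] at hv
      simp only [Option.some.injEq] at hu hv
      exact hu ▸ hv ▸ huv
    · rw [List.getElem?_eq_none (by simp; omega)] at hk
      simp at hk

theorem adj_of_treeAdj (h : IsTreeIn Γ p L) {i j : ℕ} (hij : treeAdj p i j ≠ 0) {u v : V}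
    (hu : L[i]? = some u) (hv : L[j]? = some v) : Γ.Adj u v := by
  simp only [treeAdj, ne_eq, ite_eq_right_iff, one_ne_zero, imp_false, not_not] at hij
  rcases hij with ⟨h0, h1⟩ | ⟨h0, h1⟩
  · exact (h.adj_of_parent h1 hv (by rwa [Nat.sub_add_cancel h0])).symm
  · exact h.adj_of_parent h1 hu (by rwa [Nat.sub_add_cancel h0])

theorem exists_walk (h : IsTreeIn Γ p L) {u w : V} (hu : u ∈ L) (hw : w ∈ L) :
    ∃ q : Γ.Walk u w, ∀ z ∈ q.support, z ∈ L := by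
  induction h generalizing u w with
  | single =>
    obtain rfl := List.mem_singleton.1 hu
    obtain rfl := List.mem_singleton.1 hw
    exact ⟨.nil, by simp⟩
  | @snoc p L h m x v hm hxv _ ih =>
    have hx : x ∈ L := List.mem_of_getElem? hm
    have key : ∀ {y}, y ∈ L → ∃ q : Γ.Walk y v, ∀ z ∈ q.support, z ∈ L ++ [v] := by
      intro y hy
      obtain ⟨q, hq⟩ := ih hy hx
      refine ⟨q.concat hxv, fun z hz => ?_⟩
      rw [SimpleGraph.Walk.support_concat] at hz
      simp only [List.mem_append] at hz ⊢
      exact hz.imp_left (hq z)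
    rw [List.mem_append, List.mem_singleton] at hu hw
    rcases hu with hu | rfl <;> rcases hw with hw | rfl
    · obtain ⟨q, hq⟩ := ih hu hw
      exact ⟨q, fun z hz => List.mem_append_left _ (hq z hz)⟩
    · exact key hu
    · obtain ⟨q, hq⟩ := key hw
      exact ⟨q.reverse, by simpa using hq⟩
    · exact ⟨.nil, by simp⟩

/-- A path inside the tree from `w` to `u`, preceded by the edge from `v` to `w`, is a path starting
at `v`. In an acyclic graph the only neighbour of `v` on it is its second vertex. -/
theorem eq_of_adj (h : IsTreeIn Γ p L) (hac : Γ.IsAcyclic) {u v w : V} (hv : v ∉ L) (hu : u ∈ L)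
    (hw : w ∈ L) (hvu : Γ.Adj v u) (hvw : Γ.Adj v w) : u = w := by
  classical
  obtain ⟨q, hq⟩ := h.exists_walk hw hu
  have hp : (SimpleGraph.Walk.cons hvw q.bypass).IsPath := by
    rw [SimpleGraph.Walk.cons_isPath_iff]
    exact ⟨q.bypass_isPath, fun hc => hv (hq v (q.support_bypass_subset_support hc))⟩
  simpa using hac.eq_snd_of_adj_start hp hvu (by simp)

/-- In an acyclic graph every subtree is full: each appended vertex is adjacent to exactly one
earlier vertex, by `eq_of_adj`. -/
theorem adj_iff_treeAdj (h : IsTreeIn Γ p L) (hac : Γ.IsAcyclic) {i j : ℕ} {u v : V}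
    (hu : L[i]? = some u) (hv : L[j]? = some v) : Γ.Adj u v ↔ treeAdj p i j ≠ 0 := by
  refine ⟨fun huv => ?_, fun hij => h.adj_of_treeAdj hij hu hv⟩
  induction h generalizing i j u v with
  | single x =>
    have h1 := List.mem_of_getElem? hu
    have h2 := List.mem_of_getElem? hv
    rw [List.mem_singleton] at h1 h2
    exact absurd (h1.trans h2.symm) huv.ne
  | @snoc p L h m x y hm hxy hy ih =>
    have hlen := h.length_eq
    have key : ∀ {i j : ℕ} {u v : V}, (L ++ [y])[i]? = some u → (L ++ [y])[j]? = some v →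
        Γ.Adj u v → i < L.length → treeAdj (p ++ [m]) i j ≠ 0 := by
      intro i j u v hu hv huv hi
      rw [List.getElem?_append_left hi] at hu
      rcases lt_or_ge j L.length with hj | hj
      · rw [List.getElem?_append_left hj] at hv
        have := ih hu hv huv
        simp only [treeAdj, ne_eq, ite_eq_right_iff, one_ne_zero, imp_false, not_not] at this ⊢
        refine this.imp (fun h => ⟨h.1, ?_⟩) (fun h => ⟨h.1, ?_⟩)
        · rw [List.getElem?_append_left (by omega), h.2]
        · rw [List.getElem?_append_left (by omega), h.2]
      · rw [List.getElem?_append_right hj, List.getElem?_singleton] at hv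
        split_ifs at hv with hj'
        obtain rfl : y = v := by simpa using hv
        have hux := h.eq_of_adj hac hy (List.mem_of_getElem? hu) (List.mem_of_getElem? hm)
          huv.symm hxy.symm
        subst hux
        have him : i = m := by
          obtain ⟨hi', hu'⟩ := List.getElem?_eq_some_iff.1 hu
          obtain ⟨hm', hm''⟩ := List.getElem?_eq_some_iff.1 hm
          exact (h.nodup.getElem_inj_iff).1 (hu'.trans hm''.symm)
        have hjp : j - 1 = p.length := by omega
        simp only [treeAdj, ne_eq, ite_eq_right_iff, one_ne_zero, imp_false, not_not]
        right
        refine ⟨by omega, ?_⟩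
        rw [hjp, List.getElem?_concat_length, him]
    rcases lt_or_ge i L.length with hi | hi
    · exact key hu hv huv hi
    rcases lt_or_ge j L.length with hj | hj
    · rw [treeAdj_comm]
      exact key hv hu huv.symm hj
    · rw [List.getElem?_append_right hi, List.getElem?_singleton] at hu
      rw [List.getElem?_append_right hj, List.getElem?_singleton] at hv
      split_ifs at hu hv
      exact absurd ((Option.some.inj hu).symm.trans (Option.some.inj hv)) huv.ne

/-- The vertices of a tree, as a function of the index. -/
def vertex (h : IsTreeIn Γ p L) (i : Fin (p.length + 1)) : V := L[i.1]'(by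
  rw [h.length_eq]; exact i.2)

theorem getElem?_vertex (h : IsTreeIn Γ p L) (i : Fin (p.length + 1)) :
    L[i.1]? = some (h.vertex i) :=
  List.getElem?_eq_getElem _

theorem vertex_injective (h : IsTreeIn Γ p L) : h.vertex.Injective := fun _ _ hij =>
  Fin.ext ((h.nodup.getElem_inj_iff).1 hij)

theorem mem_range_vertex (h : IsTreeIn Γ p L) {v : V} : v ∈ Set.range h.vertex ↔ v ∈ L := by
  constructor
  · rintro ⟨i, rfl⟩
    exact List.getElem_mem _
  · intro hv
    obtain ⟨i, hi, rfl⟩ := List.getElem_of_mem hv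
    exact ⟨⟨i, by rwa [h.length_eq] at hi⟩, rfl⟩

theorem treeAdj_le (h : IsTreeIn Γ p L) (i j : Fin (p.length + 1)) :
    treeAdj p i j ≤ Γ.adjNat (h.vertex i) (h.vertex j) := by
  by_cases hij : treeAdj p i j = 0
  · simp [hij]
  · have := h.adj_of_treeAdj hij (h.getElem?_vertex i) (h.getElem?_vertex j)
    simp only [SimpleGraph.adjNat, this, if_true, treeAdj]
    split_ifs <;> simp

theorem adjNat_eq (h : IsTreeIn Γ p L) (hac : Γ.IsAcyclic) (i j : Fin (p.length + 1)) :
    Γ.adjNat (h.vertex i) (h.vertex j) = treeAdj p i j := by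
  have := h.adj_iff_treeAdj hac (h.getElem?_vertex i) (h.getElem?_vertex j)
  rw [SimpleGraph.adjNat]
  split_ifs with hij
  · rw [this] at hij
    rw [treeAdj] at hij ⊢
    split_ifs at hij ⊢ <;> simp_all
  · rw [this, not_not] at hij
    exact hij.symm

theorem vertex_bijective (h : IsTreeIn Γ p L) (hL : ∀ v, v ∈ L) : h.vertex.Bijective :=
  ⟨h.vertex_injective, fun v => h.mem_range_vertex.2 (hL v)⟩

theorem realizes (h : IsTreeIn Γ p L) (hac : Γ.IsAcyclic) (hL : ∀ v, v ∈ L) (D : HypDiagram)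
    (hD : D.order = p.length + 1) (σ : List ℕ)
    (hσ : ∀ i : Fin (p.length + 1), σ.getD i 0 < p.length + 1 ∧
      ∀ j : Fin (p.length + 1), (σ.getD i 0 = σ.getD j 0 → i = j) ∧
        treeAdj p (σ.getD i 0) (σ.getD j 0) = edgeCount D.edges i j) : Realizes Γ.adjNat D :=
  realizes_of_bijective (h.vertex_bijective hL) (h.adjNat_eq hac) D hD
    (fun i => ⟨σ.getD i 0, (hσ i).1⟩) (fun i j hij => ((hσ i).2 j).1 (Fin.mk.inj hij))
    fun i j => ((hσ i).2 j).2

variable [Fintype V]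

/-- `card_le_of_embedding` for a tree and an explicit vector. Acyclicity is not needed, so it also
applies to trees inside graphs with cycles. -/
theorem cover_or_exists (h : IsTreeIn Γ p L) (hc : IsConnectedMatrix Γ.adjNat)
    (hh : IsHyperbolicMatrix Γ.adjNat) (δ : List ℕ)
    (hδ : ∀ i : Fin (p.length + 1), δ.getD i 0 ≠ 0 ∧
      2 * δ.getD i 0 ≤ ∑ j : Fin (p.length + 1), treeAdj p i j * δ.getD j 0) :
    (∀ v, v ∈ L) ∨ ∃ v ∉ L, (∃ u ∈ L, Γ.Adj u v) ∧ ∀ w, w = v ∨ w ∈ L := by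
  rcases card_le_of_embedding Γ.adjNat_comm hc hh h.vertex h.vertex_injective
    (fun i j => treeAdj p i j) h.treeAdj_le (fun i => δ.getD i 0) (Nat.succ_pos _)
    (fun i => (hδ i).1) (fun i => (hδ i).2) with h1 | ⟨v, hv, ⟨i, hi⟩, hall⟩
  · left
    intro v
    rw [← h.mem_range_vertex, h1]
    trivial
  · right
    simp only [h.mem_range_vertex] at hv hall
    exact ⟨v, hv, ⟨_, h.mem_range_vertex.1 ⟨i, rfl⟩, SimpleGraph.adjNat_ne_zero.1 hi⟩, hall⟩

/-- If the tree were everything, a positive superharmonic vector would make the form nonnegative.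
Acyclicity is essential, since extra edges would spoil the upper bound on Aδ. -/
theorem not_cover (h : IsTreeIn Γ p L) (hac : Γ.IsAcyclic) (hh : IsHyperbolicMatrix Γ.adjNat)
    (δ : List ℕ) (hδ : ∀ i : Fin (p.length + 1), δ.getD i 0 ≠ 0 ∧
      ∑ j : Fin (p.length + 1), treeAdj p i j * δ.getD j 0 ≤ 2 * δ.getD i 0) :
    ¬ ∀ v, v ∈ L := by
  intro hL
  obtain ⟨x, hx⟩ := hh.1
  refine absurd (cartanForm_nonneg_of_bijective Γ.adjNat_comm _ (h.vertex_bijective hL)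
    (fun i => δ.getD i 0) (fun i => (hδ i).1) (fun i => ?_) x) (not_le.2 hx)
  simp_rw [h.adjNat_eq hac]
  exact (hδ i).2

end IsTreeIn

theorem exists_adj_notMem (hc : IsConnectedMatrix Γ.adjNat) {L : List V} (hne : L ≠ [])
    (hL : ¬ ∀ v, v ∈ L) : ∃ u ∈ L, ∃ v ∉ L, Γ.Adj u v := by
  by_contra! hcon
  have := hc.2 {v | v ∈ L} (List.exists_mem_of_ne_nil L hne) fun u hu v huv => by
    by_contra hv
    exact hcon u hu v hv (SimpleGraph.adjNat_ne_zero.1 huv)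
  exact hL fun v => by
    have h2 := Set.mem_univ v
    rwa [← this] at h2

end Trees

/-! ### Simple graphs containing a cycle -/

section Cycles

variable {V : Type*} {Γ : SimpleGraph V}

/-- The vertices `c 0, …, c m` form a cycle (of length `m + 1 ≥ 3`, possibly with chords). -/
structure IsCycleSeq (Γ : SimpleGraph V) (m : ℕ) (c : ℕ → V) : Prop where
  two_le : 2 ≤ m
  inj : ∀ i ≤ m, ∀ j ≤ m, c i = c j → i = j
  adj_succ : ∀ i < m, Γ.Adj (c i) (c (i + 1))
  adj_last : Γ.Adj (c m) (c 0)

theorem exists_isCycleSeq_of_not_isAcyclic (h : ¬ Γ.IsAcyclic) : ∃ m c, IsCycleSeq Γ m c := by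
  simp only [SimpleGraph.IsAcyclic, not_forall, not_not] at h
  obtain ⟨v, w, hw⟩ := h
  have hl := hw.three_le_length
  refine ⟨w.length - 1, w.getVert, by omega, fun i hi j hj hij => ?_, fun i hi => ?_, ?_⟩
  · exact hw.getVert_injOn' (by simpa using hi) (by simpa using hj) hij
  · exact w.adj_getVert_succ (by omega)
  · rw [w.getVert_zero]
    have := w.adj_getVert_succ (i := w.length - 1) (by omega)
    rwa [Nat.sub_add_cancel (by omega), w.getVert_length] at this

namespace IsCycleSeq

variable {m : ℕ} {c : ℕ → V}

/-- Allows the neighbour of the outside vertex to be taken as `c 0`, and exchanges the two arcs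
between a pair of vertices. -/
theorem rotate (h : IsCycleSeq Γ m c) (k : ℕ) :
    IsCycleSeq Γ m fun i => c ((i + k) % (m + 1)) := by
  have hadj : ∀ i, Γ.Adj (c (i % (m + 1))) (c ((i + 1) % (m + 1))) := by
    intro i
    have hlt : i % (m + 1) < m + 1 := Nat.mod_lt i (Nat.succ_pos m)
    rw [Nat.add_mod i 1, Nat.mod_eq_of_lt (a := 1) (by have := h.two_le; omega)]
    rcases Nat.lt_succ_iff_lt_or_eq.1 hlt with h1 | h1
    · rw [Nat.mod_eq_of_lt (a := i % (m + 1) + 1) (by omega)]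
      exact h.adj_succ _ h1
    · rw [h1, Nat.mod_self]
      exact h.adj_last
  refine ⟨h.two_le, fun i hi j hj hij => ?_, fun i _ => ?_, ?_⟩
  · have h1 := h.inj _ (Nat.lt_succ_iff.1 (Nat.mod_lt _ (Nat.succ_pos m))) _
      (Nat.lt_succ_iff.1 (Nat.mod_lt _ (Nat.succ_pos m))) hij
    have h2 : i ≡ j [MOD (m + 1)] := Nat.ModEq.add_right_cancel' k h1
    exact Nat.ModEq.eq_of_lt_of_lt h2 (by omega) (by omega)
  · rw [show i + 1 + k = i + k + 1 by ring]
    exact hadj _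
  · have := hadj (m + k)
    rwa [show m + k + 1 = 0 + k + (m + 1) by ring, Nat.add_mod_right] at this

/-- Two vertices of a shortest cycle are adjacent only if they are consecutive. -/
theorem adj_iff (h : IsCycleSeq Γ m c) (hmin : ∀ m' c', IsCycleSeq Γ m' c' → m ≤ m') {i j : ℕ}
    (hi : i ≤ m) (hj : j ≤ m) : Γ.Adj (c i) (c j) ↔
      j = i + 1 ∨ i = j + 1 ∨ (i = 0 ∧ j = m) ∨ (j = 0 ∧ i = m) := by
  constructor
  · have key : ∀ {i j : ℕ}, i < j → j ≤ m → Γ.Adj (c i) (c j) → j = i + 1 ∨ (i = 0 ∧ j = m) := by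
      intro i j hij hj hadj
      by_contra! hcon
      have := hmin (j - i) (fun k => c (i + k)) ⟨by omega, fun k hk l hl hkl => by
        have := h.inj _ (by omega) _ (by omega) hkl
        omega, fun k hk => h.adj_succ _ (by omega), by
          rw [Nat.add_sub_cancel' hij.le]
          exact hadj.symm⟩
      omega
    intro hadj
    rcases lt_trichotomy i j with hij | rfl | hij
    · have := key hij hj hadj
      omega
    · exact absurd rfl hadj.ne
    · have := key hij hi hadj.symm
      omega
  · rintro (rfl | rfl | ⟨rfl, rfl⟩ | ⟨rfl, rfl⟩)
    exacts [h.adj_succ _ (by omega), (h.adj_succ _ (by omega)).symm, h.adj_last.symm, h.adj_last]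

/-- The arc `c 0, …, c j` closed up through `v` is a cycle with j + 2 vertices, while a shortest one
has m + 1. -/
theorem le_of_adj (h : IsCycleSeq Γ m c) (hmin : ∀ m' c', IsCycleSeq Γ m' c' → m ≤ m') {v : V}
    (hv : ∀ i ≤ m, c i ≠ v) {j : ℕ} (hj0 : 0 < j) (hj : j ≤ m) (h0 : Γ.Adj v (c 0))
    (h1 : Γ.Adj v (c j)) : m ≤ j + 1 := by
  refine hmin (j + 1) (fun i => if i ≤ j then c i else v)
    ⟨by omega, fun k hk l hl hkl => ?_, fun k hk => ?_, ?_⟩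
  · split_ifs at hkl with h2 h3 h3
    · exact h.inj _ (by omega) _ (by omega) hkl
    · exact absurd hkl (hv _ (by omega))
    · exact absurd hkl.symm (hv _ (by omega))
    · omega
  · rcases Nat.lt_succ_iff_lt_or_eq.1 hk with h2 | rfl
    · simpa [h2.le, Nat.succ_le_of_lt h2] using h.adj_succ k (by omega)
    · simpa using h1.symm
  · simpa using h0

/-- `le_of_adj` for the complementary arc, from `c j` onwards to `c 0`, in which `c 0` has position
m + 1 − j. -/
theorem le_two_of_adj (h : IsCycleSeq Γ m c) (hmin : ∀ m' c', IsCycleSeq Γ m' c' → m ≤ m') {v : V}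
    (hv : ∀ i ≤ m, c i ≠ v) {j : ℕ} (hj0 : 0 < j) (hj : j ≤ m) (h0 : Γ.Adj v (c 0))
    (h1 : Γ.Adj v (c j)) : j ≤ 2 := by
  have := (h.rotate j).le_of_adj hmin (v := v)
    (fun i _ => hv _ (Nat.lt_succ_iff.1 (Nat.mod_lt _ (Nat.succ_pos m)))) (j := m + 1 - j)
    (by omega) (by omega) (by rwa [Nat.zero_add, Nat.mod_eq_of_lt (by omega)])
    (by rwa [Nat.sub_add_cancel (by omega), Nat.mod_self])
  omega

/-- The adjacency matrix of a cycle with `m + 1` vertices `0, …, m`, and one more vertex joined to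
those in the list `l`. -/
def _root_.coneAdj (m : ℕ) (l : List ℕ) (i j : ℕ) : ℕ :=
  if (i ≤ m ∧ j ≤ m ∧ (j = i + 1 ∨ i = j + 1 ∨ (i = 0 ∧ j = m) ∨ (j = 0 ∧ i = m))) ∨
    (m < i ∧ j ≤ m ∧ j ∈ l) ∨ (i ≤ m ∧ m < j ∧ i ∈ l) then 1 else 0

theorem realizes (h : IsCycleSeq Γ m c) (hmin : ∀ m' c', IsCycleSeq Γ m' c' → m ≤ m') {v : V}
    (hv : ∀ i ≤ m, c i ≠ v) (hall : ∀ w, w = v ∨ ∃ i ≤ m, c i = w) {l : List ℕ}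
    (hl : ∀ i ≤ m, Γ.Adj v (c i) ↔ i ∈ l) (D : HypDiagram)
    (hD : D.order = m + 2) (σ : List ℕ)
    (hσ : ∀ i : Fin (m + 2), σ.getD i 0 < m + 2 ∧
      ∀ j : Fin (m + 2), (σ.getD i 0 = σ.getD j 0 → i = j) ∧
        coneAdj m l (σ.getD i 0) (σ.getD j 0) = edgeCount D.edges i j) : Realizes Γ.adjNat D := by
  classical
  let f : Fin (m + 2) → V := fun i => if i.1 ≤ m then c i else v
  have hf : f.Bijective := by
    refine ⟨fun i j hij => Fin.ext ?_, fun w => ?_⟩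
    · simp only [f] at hij
      split_ifs at hij with h2 h3 h3
      · exact h.inj _ h2 _ h3 hij
      · exact absurd hij (hv _ h2)
      · exact absurd hij.symm (hv _ h3)
      · omega
    · rcases hall w with rfl | ⟨i, hi, rfl⟩
      · exact ⟨⟨m + 1, by omega⟩, by simp [f]⟩
      · exact ⟨⟨i, by omega⟩, by simp [f, hi]⟩
  refine realizes_of_bijective hf (b := fun i j => coneAdj m l i j) (fun i j => ?_) D hD
    (fun i => ⟨σ.getD i 0, (hσ i).1⟩) (fun i j hij => ((hσ i).2 j).1 (Fin.mk.inj hij))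
    fun i j => ((hσ i).2 j).2
  rw [SimpleGraph.adjNat, coneAdj]
  refine if_congr ?_ rfl rfl
  simp only [f]
  split_ifs with hi hj hj
  · simp [h.adj_iff hmin hi hj, hi, hj]
  · rw [Γ.adj_comm, hl _ hi]
    simp [hi, hj]
    omega
  · rw [hl _ hj]
    simp [hi, hj]
    omega
  · simp [hi, hj]

/-- A shortest cycle has no chords, so the all-ones vector lies in the radical of the form on it. -/
theorem sum_adjNat (h : IsCycleSeq Γ m c) (hmin : ∀ m' c', IsCycleSeq Γ m' c' → m ≤ m')
    (i : Fin (m + 1)) : ∑ j : Fin (m + 1), Γ.adjNat (c i) (c j) = 2 := by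
  classical
  have hm := h.two_le
  have hi := i.2
  simp only [SimpleGraph.adjNat, Finset.sum_boole, Nat.cast_id]
  rw [Finset.card_eq_two]
  refine ⟨⟨if i.1 = m then 0 else i + 1, by split_ifs <;> omega⟩,
    ⟨if i.1 = 0 then m else i - 1, by split_ifs <;> omega⟩, ?_, ?_⟩
  · rw [Ne, Fin.mk.injEq]
    split_ifs <;> omega
  · ext j
    have hj := j.2
    simp only [Finset.mem_filter, Finset.mem_univ, true_and, Finset.mem_insert,
      Finset.mem_singleton, Fin.ext_iff]
    rw [h.adj_iff hmin (by omega) (by omega)]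
    split_ifs <;> omega

variable [Fintype V]

/-- For m ≥ 8 the centre `c 0`, the short arm `v` and three further vertices in each direction along
the cycle form an extended E7 tree, and at least two vertices of the cycle are left over. -/
theorem le_seven (h : IsCycleSeq Γ m c) (hc : IsConnectedMatrix Γ.adjNat)
    (hh : IsHyperbolicMatrix Γ.adjNat) {v : V} (hv : ∀ i ≤ m, c i ≠ v)
    (h0 : Γ.Adj v (c 0)) : m ≤ 7 := by
  by_contra! hm
  have hadj : ∀ {i j : ℕ}, i < m → j = i + 1 → Γ.Adj (c i) (c j) := fun hi hj =>
    hj ▸ h.adj_succ _ hi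
  have hv' : ∀ {i : ℕ}, i ≤ m → (c i = v) = False := fun hi => eq_false (hv _ hi)
  have hv'' : ∀ {i : ℕ}, i ≤ m → (v = c i) = False := fun hi => eq_false fun e => hv _ hi e.symm
  have hne' : ∀ {i j : ℕ}, i ≤ m → j ≤ m → i ≠ j → (c i = c j) = False := fun hi hj hij =>
    eq_false fun e => hij (h.inj _ hi _ hj e)
  obtain ⟨n, rfl⟩ : ∃ n, m = n + 8 := ⟨m - 8, by omega⟩
  have T := ((((((IsTreeIn.single (Γ := Γ) (c 0)).snoc 0 rfl h0.symm (v := v)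
    (by simp [hv''])).snoc 0 rfl (hadj (j := 1) (by omega) (by omega))
    (by simp [hne', hv'])).snoc 2 rfl (hadj (j := 2) (by omega) (by omega))
    (by simp [hne', hv'])).snoc 3 rfl (hadj (j := 3) (by omega) (by omega))
    (by simp [hne', hv'])).snoc 0 rfl h.adj_last.symm
    (by simp [hne', hv'])).snoc 5 rfl (hadj (i := n + 7) (by omega) (by omega)).symm
    (by simp [hne', hv']) |>.snoc 6 rfl (hadj (i := n + 6) (by omega) (by omega)).symm
    (by simp [hne', hv'])
  -- Positions 4 and 5 lie strictly between the ends 3 and n + 6 of the two long arms.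
  have h4 : c 4 ∉ [c 0, v, c 1, c 2, c 3, c (n + 8), c (n + 7), c (n + 6)] := by
    simp [hne', hv']
  have h5 : c 5 ∉ [c 0, v, c 1, c 2, c 3, c (n + 8), c (n + 7), c (n + 6)] := by
    simp [hne', hv']
  rcases T.cover_or_exists hc hh [4, 2, 3, 2, 1, 3, 2, 1] (by decide) with h1 | ⟨w, -, -, h1⟩
  · exact h4 (h1 _)
  · have e4 := (h1 (c 4)).resolve_right h4
    have e5 := (h1 (c 5)).resolve_right h5
    exact absurd (h.inj _ (by omega) _ (by omega) (e4.trans e5.symm)) (by decide)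

/-- If `c 0` is the only neighbour of `v`, the graph is an overextended A diagram. A second
neighbour `c j` satisfies m − 1 ≤ j ≤ 2, since both arcs between the two neighbours close up to
cycles through `v`. Hence m ≤ 3, and for m = 3 the two neighbours are opposite. -/
theorem exists_realizes_of_adj_zero (h : IsCycleSeq Γ m c)
    (hmin : ∀ m' c', IsCycleSeq Γ m' c' → m ≤ m') (hc : IsConnectedMatrix Γ.adjNat)
    (hh : IsHyperbolicMatrix Γ.adjNat) {v : V} (hv : ∀ i ≤ m, c i ≠ v)
    (hall : ∀ w, w = v ∨ ∃ i ≤ m, c i = w) (h0 : Γ.Adj v (c 0)) :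
    ∃ D : HypDiagram, D.IsListed ∧ Realizes Γ.adjNat D := by
  have hm7 := h.le_seven hc hh hv h0
  have hm2 := h.two_le
  have hle : ∀ i ≤ m, 0 < i → Γ.Adj v (c i) → m ≤ i + 1 ∧ i ≤ 2 := fun i hi hi0 hadj =>
    ⟨h.le_of_adj hmin hv hi0 hi h0 hadj, h.le_two_of_adj hmin hv hi0 hi h0 hadj⟩
  have real := fun l hl D => h.realizes hmin hv hall (l := l) hl D
  by_cases hN : ∀ i ≤ m, 0 < i → ¬ Γ.Adj v (c i)
  · replace real := real [0] fun i hi => by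
      rcases Nat.eq_zero_or_pos i with rfl | hi0
      · simp [h0]
      · simp [hN i hi hi0, hi0.ne']
    refine ⟨overext (.A m), ⟨by omega, hm7⟩, ?_⟩
    clear h hmin hv hall hle hN h0
    interval_cases m
    · exact real _ rfl [0, 1, 2, 3] (by decide +kernel)
    · exact real _ rfl [0, 1, 2, 3, 4] (by decide +kernel)
    · exact real _ rfl [0, 1, 2, 3, 4, 5] (by decide +kernel)
    · exact real _ rfl [0, 1, 2, 3, 4, 5, 6] (by decide +kernel)
    · exact real _ rfl [0, 1, 2, 3, 4, 5, 6, 7] (by decide +kernel)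
    · exact real _ rfl [0, 1, 2, 3, 4, 5, 6, 7, 8] (by decide +kernel)
  push Not at hN
  obtain ⟨j, hj, hj0, hvj⟩ := hN
  have hm3 : m ≤ 3 := by
    have := hle j hj hj0 hvj
    omega
  obtain rfl | rfl : m = 2 ∨ m = 3 := by omega
  · by_cases h1 : Γ.Adj v (c 1) <;> by_cases h2 : Γ.Adj v (c 2)
    · exact ⟨hypA22, trivial, real [0, 1, 2] (fun i hi => by interval_cases i <;> simp [*]) _ rfl
        [0, 1, 2, 3] (by decide +kernel)⟩
    · exact ⟨hypA21, trivial, real [0, 1] (fun i hi => by interval_cases i <;> simp [*]) _ rfl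
        [0, 1, 2, 3] (by decide +kernel)⟩
    · exact ⟨hypA21, trivial, real [0, 2] (fun i hi => by interval_cases i <;> simp [*]) _ rfl
        [0, 2, 1, 3] (by decide +kernel)⟩
    · interval_cases j <;> contradiction
  · have h1 : ¬ Γ.Adj v (c 1) := fun h => by have := hle 1 (by omega) one_pos h; omega
    have h3 : ¬ Γ.Adj v (c 3) := fun h => by have := hle 3 (by omega) (by omega) h; omega
    have h2 : Γ.Adj v (c 2) := by interval_cases j <;> first | contradiction | assumption
    exact ⟨hypA31, trivial, real [0, 2] (fun i hi => by interval_cases i <;> simp [*]) _ rfl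
      [0, 1, 2, 3, 4] (by decide +kernel)⟩

theorem exists_realizes (h : IsCycleSeq Γ m c) (hmin : ∀ m' c', IsCycleSeq Γ m' c' → m ≤ m')
    (hc : IsConnectedMatrix Γ.adjNat) (hh : IsHyperbolicMatrix Γ.adjNat) :
    ∃ D : HypDiagram, D.IsListed ∧ Realizes Γ.adjNat D := by
  have hfi : Function.Injective fun i : Fin (m + 1) => c i := fun i j hij =>
    Fin.ext (h.inj _ (by omega) _ (by omega) hij)
  rcases card_le_of_embedding Γ.adjNat_comm hc hh (fun i : Fin (m + 1) => c i) hfi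
    (fun i j => Γ.adjNat (c i) (c j)) (fun _ _ => le_rfl) 1 (Nat.succ_pos m) (by simp)
    (fun i => by simp [h.sum_adjNat hmin]) with h1 | ⟨v, hv, ⟨k, hk⟩, hall⟩
  · exfalso
    obtain ⟨x, hx⟩ := hh.1
    exact absurd (cartanForm_nonneg_of_bijective Γ.adjNat_comm _ ⟨hfi, Set.range_eq_univ.1 h1⟩ 1
      (by simp) (fun i => by simp [h.sum_adjNat hmin]) x) (not_le.2 hx)
  have hm := h.two_le
  have h' := h.rotate k
  have hvk : Γ.Adj v (c ((0 + k) % (m + 1))) := by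
    rw [Nat.zero_add, Nat.mod_eq_of_lt k.2]
    exact (SimpleGraph.adjNat_ne_zero.1 hk).symm
  have hv' : ∀ i ≤ m, c ((i + k) % (m + 1)) ≠ v := fun i _ hi =>
    hv ⟨⟨(i + k) % (m + 1), Nat.mod_lt _ (Nat.succ_pos m)⟩, hi⟩
  have hall' : ∀ w, w = v ∨ ∃ i ≤ m, c ((i + k) % (m + 1)) = w := by
    intro w
    refine (hall w).imp_right ?_
    rintro ⟨i, rfl⟩
    have hi := i.2
    have hk := k.2
    rcases le_or_gt k.1 i.1 with hki | hki
    · refine ⟨i - k, by omega, ?_⟩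
      rw [Nat.sub_add_cancel hki, Nat.mod_eq_of_lt hi]
    · refine ⟨i + (m + 1) - k, by omega, ?_⟩
      rw [Nat.sub_add_cancel (by omega), Nat.add_mod_right, Nat.mod_eq_of_lt hi]
  exact h'.exists_realizes_of_adj_zero hmin hc hh hv' hall' hvk

end IsCycleSeq

end Cycles

/-! ### Trees with one branch vertex, of degree three -/

section Branch

variable {V : Type*} {Γ : SimpleGraph V}

/-- If `v` were already in the tree, it would be one of the tree neighbours of its attaching vertex.
So it is enough to compare `v` with the entries at the few positions in `ns`. -/
theorem IsTreeIn.snoc_of_acyclic {p : List ℕ} {L : List V} (h : IsTreeIn Γ p L) (hac : Γ.IsAcyclic)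
    (k : ℕ) {u v : V} (hk : L[k]? = some u) (huv : Γ.Adj u v) (ns : List ℕ)
    (h1 : ∀ j : Fin (p.length + 1), treeAdj p k j ≠ 0 → j.1 ∈ ns)
    (h2 : ∀ j ∈ ns, L[j]? ≠ some v) : IsTreeIn Γ (p ++ [k]) (L ++ [v]) := by
  refine h.snoc k hk huv fun hv => ?_
  obtain ⟨j, hj, hjv⟩ := List.getElem_of_mem hv
  have hj' : L[j]? = some v := List.getElem?_eq_some_iff.2 ⟨hj, hjv⟩
  exact h2 j (h1 ⟨j, by rwa [← h.length_eq]⟩ ((h.adj_iff_treeAdj hac hk hj').1 huv)) hj'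

/-- The vertex `c` has exactly the three neighbours `x`, `y`, `z`, and any other vertex has at most
two neighbours. -/
structure IsBranch (Γ : SimpleGraph V) (c x y z : V) : Prop where
  adj_fst : Γ.Adj c x
  adj_snd : Γ.Adj c y
  adj_trd : Γ.Adj c z
  fst_ne_snd : x ≠ y
  fst_ne_trd : x ≠ z
  snd_ne_trd : y ≠ z
  eq_or_eq_or_eq : ∀ {v}, Γ.Adj c v → v = x ∨ v = y ∨ v = z
  eq_or_eq : ∀ {u p q v}, u ≠ c → Γ.Adj u p → Γ.Adj u q → p ≠ q → Γ.Adj u v → v = p ∨ v = q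

namespace IsBranch

variable {c x y z : V}

theorem swap (h : IsBranch Γ c x y z) : IsBranch Γ c x z y :=
  ⟨h.1, h.3, h.2, h.5, h.4, h.6.symm, fun hv => (h.7 hv).imp_right Or.symm, h.8⟩

theorem cycle (h : IsBranch Γ c x y z) : IsBranch Γ c y z x :=
  ⟨h.2, h.3, h.1, h.6, h.4.symm, h.5.symm, fun hv => by
    have := h.7 hv
    tauto, h.8⟩

theorem isTreeIn (h : IsBranch Γ c x y z) : IsTreeIn Γ [0, 0, 0] [c, x, y, z] :=
  (((IsTreeIn.single c).snoc 0 rfl h.1 (by simp [h.1.ne'])).snoc 0 rfl h.2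
    (by simp [h.2.ne', h.4.symm])).snoc 0 rfl h.3 (by simp [h.3.ne', h.5.symm, h.6.symm])

variable [Fintype V]

/-- Three arms of length at least two contain an extended E6. All its vertices except the ends of
the arms already have all their neighbours in it, so the one remaining vertex prolongs an arm. -/
theorem exists_realizes_of_two_two_two (h : IsBranch Γ c x y z) (hac : Γ.IsAcyclic)
    (hc : IsConnectedMatrix Γ.adjNat) (hh : IsHyperbolicMatrix Γ.adjNat) {x' y' z' : V}
    (hx : Γ.Adj x x') (hy : Γ.Adj y y') (hz : Γ.Adj z z') (hxc : x' ≠ c) (hyc : y' ≠ c)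
    (hzc : z' ≠ c) : ∃ D : HypDiagram, D.IsListed ∧ Realizes Γ.adjNat D := by
  have T : IsTreeIn Γ [0, 0, 0, 1, 2, 3] [c, x, y, z, x', y', z'] :=
    ((h.isTreeIn.snoc_of_acyclic hac 1 rfl hx [0] (by decide)
      (by simpa using hxc.symm)).snoc_of_acyclic hac 2 rfl hy [0] (by decide)
      (by simpa using hyc.symm)).snoc_of_acyclic hac 3 rfl hz [0] (by decide)
      (by simpa using hzc.symm)
  rcases T.cover_or_exists hc hh [3, 2, 2, 2, 1, 1, 1] (by decide) with h1 | ⟨v, hv, hadj, h1⟩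
  · exact absurd h1 (T.not_cover hac hh [3, 2, 2, 2, 1, 1, 1] (by decide))
  have cov : ∀ w, w ∈ [c, x, y, z, x', y', z'] ++ [v] := fun w =>
    List.mem_append.2 ((h1 w).symm.imp_right (by simp))
  simp only [List.mem_cons, List.not_mem_nil, or_false, exists_eq_or_imp, exists_eq_left] at hadj
  rcases hadj with e | e | e | e | e | e | e
  · exact absurd (by rcases h.7 e with rfl | rfl | rfl <;> simp) hv
  · exact absurd (by rcases h.8 h.1.ne' h.1.symm hx hxc.symm e with rfl | rfl <;> simp) hv
  · exact absurd (by rcases h.8 h.2.ne' h.2.symm hy hyc.symm e with rfl | rfl <;> simp) hv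
  · exact absurd (by rcases h.8 h.3.ne' h.3.symm hz hzc.symm e with rfl | rfl <;> simp) hv
  · exact ⟨overext .E6, trivial, (T.snoc 4 rfl e hv).realizes hac cov _ rfl
      [4, 5, 1, 2, 0, 3, 6, 7] (by decide +kernel)⟩
  · exact ⟨overext .E6, trivial, (T.snoc 5 rfl e hv).realizes hac cov _ rfl
      [5, 4, 2, 1, 0, 3, 6, 7] (by decide +kernel)⟩
  · exact ⟨overext .E6, trivial, (T.snoc 6 rfl e hv).realizes hac cov _ rfl
      [6, 4, 3, 1, 0, 2, 5, 7] (by decide +kernel)⟩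

/-- The same argument with extended E7; the arm through `x` has length one and cannot be prolonged.
-/
theorem exists_realizes_of_one_three_three (h : IsBranch Γ c x y z) (hac : Γ.IsAcyclic)
    (hc : IsConnectedMatrix Γ.adjNat) (hh : IsHyperbolicMatrix Γ.adjNat) {y' z' y'' z'' : V}
    (hx : ∀ v, Γ.Adj x v → v = c) (hy : Γ.Adj y y') (hz : Γ.Adj z z') (hyc : y' ≠ c) (hzc : z' ≠ c)
    (hy' : Γ.Adj y' y'') (hz' : Γ.Adj z' z'') (hyy : y'' ≠ y) (hzz : z'' ≠ z) :
    ∃ D : HypDiagram, D.IsListed ∧ Realizes Γ.adjNat D := by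
  have T : IsTreeIn Γ [0, 0, 0, 2, 3, 4, 5] [c, x, y, z, y', z', y'', z''] :=
    (((h.isTreeIn.snoc_of_acyclic hac 2 rfl hy [0] (by decide)
      (by simpa using hyc.symm)).snoc_of_acyclic hac 3 rfl hz [0] (by decide)
      (by simpa using hzc.symm)).snoc_of_acyclic hac 4 rfl hy' [2] (by decide)
      (by simpa using hyy.symm)).snoc_of_acyclic hac 5 rfl hz' [3] (by decide)
      (by simpa using hzz.symm)
  rcases T.cover_or_exists hc hh [4, 2, 3, 3, 2, 2, 1, 1] (by decide) with h1 | ⟨v, hv, hadj, h1⟩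
  · exact absurd h1 (T.not_cover hac hh [4, 2, 3, 3, 2, 2, 1, 1] (by decide))
  have cov : ∀ w, w ∈ [c, x, y, z, y', z', y'', z''] ++ [v] := fun w =>
    List.mem_append.2 ((h1 w).symm.imp_right (by simp))
  simp only [List.mem_cons, List.not_mem_nil, or_false, exists_eq_or_imp, exists_eq_left] at hadj
  rcases hadj with e | e | e | e | e | e | e | e
  · exact absurd (by rcases h.7 e with rfl | rfl | rfl <;> simp) hv
  · exact absurd (by simp [hx v e]) hv
  · exact absurd (by rcases h.8 h.2.ne' h.2.symm hy hyc.symm e with rfl | rfl <;> simp) hv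
  · exact absurd (by rcases h.8 h.3.ne' h.3.symm hz hzc.symm e with rfl | rfl <;> simp) hv
  · exact absurd (by rcases h.8 hyc hy.symm hy' hyy.symm e with rfl | rfl <;> simp) hv
  · exact absurd (by rcases h.8 hzc hz.symm hz' hzz.symm e with rfl | rfl <;> simp) hv
  · exact ⟨overext .E7, trivial, (T.snoc 6 rfl e hv).realizes hac cov _ rfl
      [6, 4, 1, 2, 0, 3, 5, 7, 8] (by decide +kernel)⟩
  · exact ⟨overext .E7, trivial, (T.snoc 7 rfl e hv).realizes hac cov _ rfl
      [7, 5, 1, 3, 0, 2, 4, 6, 8] (by decide +kernel)⟩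

/-- With arms of length exactly one and two, only the third arm can grow. Its lengths two, three and
four give E6, E7 and E8, length five gives extended E8; none of these is wild, so a sixth vertex
exists, and the extended E8 leaves room for no more. -/
theorem exists_realizes_of_one_two (h : IsBranch Γ c x y z) (hac : Γ.IsAcyclic)
    (hc : IsConnectedMatrix Γ.adjNat) (hh : IsHyperbolicMatrix Γ.adjNat) {y' z' : V}
    (hx : ∀ v, Γ.Adj x v → v = c) (hy : Γ.Adj y y') (hz : Γ.Adj z z') (hyc : y' ≠ c) (hzc : z' ≠ c)
    (hy' : ∀ v, Γ.Adj y' v → v = y) : ∃ D : HypDiagram, D.IsListed ∧ Realizes Γ.adjNat D := by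
  have T : IsTreeIn Γ [0, 0, 0, 2, 3] [c, x, y, z, y', z'] :=
    (h.isTreeIn.snoc_of_acyclic hac 2 rfl hy [0] (by decide)
      (by simpa using hyc.symm)).snoc_of_acyclic hac 3 rfl hz [0] (by decide)
      (by simpa using hzc.symm)
  have sat : ∀ v, Γ.Adj c v ∨ Γ.Adj x v ∨ Γ.Adj y v ∨ Γ.Adj z v ∨ Γ.Adj y' v →
      v ∈ [c, x, y, z, y', z'] := by
    rintro v (e | e | e | e | e)
    · rcases h.7 e with rfl | rfl | rfl <;> simp
    · simp [hx v e]
    · rcases h.8 h.2.ne' h.2.symm hy hyc.symm e with rfl | rfl <;> simp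
    · rcases h.8 h.3.ne' h.3.symm hz hzc.symm e with rfl | rfl <;> simp
    · simp [hy' v e]
  have grow : ∀ M : List V, (¬ ∀ v, v ∈ [c, x, y, z, y', z'] ++ M) →
      ∃ v ∉ [c, x, y, z, y', z'] ++ M, ∃ u ∈ z' :: M, Γ.Adj u v := by
    intro M hM
    obtain ⟨u, hu, v, hv, huv⟩ := exists_adj_notMem hc (by simp) hM
    refine ⟨v, hv, u, ?_, huv⟩
    have := fun H => hv (List.mem_append_left _ (sat v H))
    simp only [List.mem_append, List.mem_cons, List.not_mem_nil, or_false] at hu ⊢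
    rcases hu with (rfl | rfl | rfl | rfl | rfl | rfl) | hu
    all_goals tauto
  -- The radical vector of extended E8, cut off along the growing arm: truncation only lowers the
  -- neighbour sum at the end, so the vector stays superharmonic at each stage.
  obtain ⟨v₁, hv₁, hadj₁⟩ := grow [] (T.not_cover hac hh [6, 3, 4, 5, 2, 4] (by decide))
  simp only [List.mem_cons, List.not_mem_nil, or_false, exists_eq_left] at hadj₁
  have T₁ := T.snoc 5 rfl hadj₁ hv₁
  obtain ⟨v₂, hv₂, hadj₂⟩ := grow [v₁] (T₁.not_cover hac hh [6, 3, 4, 5, 2, 4, 3] (by decide))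
  simp only [List.mem_cons, List.not_mem_nil, or_false, exists_eq_or_imp, exists_eq_left] at hadj₂
  have hz₁ : z' ≠ v₁ := hadj₁.ne
  have e₂ : Γ.Adj v₁ v₂ := hadj₂.resolve_left fun e => hv₂ (by
    rcases h.8 hzc hz.symm hadj₁ (fun e => hv₁ (by simp [← e])) e with rfl | rfl <;> simp)
  have T₂ := T₁.snoc 6 rfl e₂ hv₂
  obtain ⟨v₃, hv₃, hadj₃⟩ := grow [v₁, v₂] (T₂.not_cover hac hh [6, 3, 4, 5, 2, 4, 3, 2] (by decide))
  simp only [List.mem_cons, List.not_mem_nil, or_false, exists_eq_or_imp, exists_eq_left] at hadj₃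
  have s₁ : ∀ v, Γ.Adj z' v → v = z ∨ v = v₁ := fun v =>
    h.8 hzc hz.symm hadj₁ (fun e => hv₁ (by simp [← e]))
  have s₂ : ∀ v, Γ.Adj v₁ v → v = z' ∨ v = v₂ := fun v =>
    h.8 (fun e => hv₁ (by simp [e])) hadj₁.symm e₂ (fun e => hv₂ (by simp [← e]))
  have e₃ : Γ.Adj v₂ v₃ := by
    rcases hadj₃ with e | e | e
    · exact absurd (by rcases s₁ _ e with rfl | rfl <;> simp) hv₃
    · exact absurd (by rcases s₂ _ e with rfl | rfl <;> simp) hv₃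
    · exact e
  have s₃ : ∀ v, Γ.Adj v₂ v → v = v₁ ∨ v = v₃ := fun v =>
    h.8 (fun e => hv₂ (by simp [e])) e₂.symm e₃ (fun e => hv₃ (by simp [← e]))
  have T₃ := T₂.snoc 7 rfl e₃ hv₃
  rcases T₃.cover_or_exists hc hh [6, 3, 4, 5, 2, 4, 3, 2, 1] (by decide)
    with h1 | ⟨v, hv, hadj, h1⟩
  · exact absurd h1 (T₃.not_cover hac hh [6, 3, 4, 5, 2, 4, 3, 2, 1] (by decide))
  obtain ⟨v₄, hv₄, hadj₄⟩ := grow [v₁, v₂, v₃] fun H => hv (H v)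
  obtain rfl : v₄ = v := (h1 v₄).resolve_right hv₄
  simp only [List.mem_cons, List.not_mem_nil, or_false, exists_eq_or_imp, exists_eq_left] at hadj₄
  have e₄ : Γ.Adj v₃ v₄ := by
    rcases hadj₄ with e | e | e | e
    · exact absurd (by rcases s₁ _ e with rfl | rfl <;> simp) hv₄
    · exact absurd (by rcases s₂ _ e with rfl | rfl <;> simp) hv₄
    · exact absurd (by rcases s₃ _ e with rfl | rfl <;> simp) hv₄
    · exact e
  exact ⟨overext .E8, trivial, (T₃.snoc 8 rfl e₄ hv).realizes hac
    (fun w => List.mem_append.2 ((h1 w).symm.imp_right (by simp))) _ rfl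
    [8, 4, 1, 2, 0, 3, 5, 6, 7, 9] (by decide +kernel)⟩

theorem exists_realizes_of_two_two (h : IsBranch Γ c x y z) (hac : Γ.IsAcyclic)
    (hc : IsConnectedMatrix Γ.adjNat) (hh : IsHyperbolicMatrix Γ.adjNat) {y' z' : V}
    (hy : Γ.Adj y y') (hz : Γ.Adj z z') (hyc : y' ≠ c) (hzc : z' ≠ c) :
    ∃ D : HypDiagram, D.IsListed ∧ Realizes Γ.adjNat D := by
  by_cases hx : ∀ v, Γ.Adj x v → v = c
  · by_cases hy' : ∀ v, Γ.Adj y' v → v = y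
    · exact h.exists_realizes_of_one_two hac hc hh hx hy hz hyc hzc hy'
    by_cases hz' : ∀ v, Γ.Adj z' v → v = z
    · exact h.swap.exists_realizes_of_one_two hac hc hh hx hz hy hzc hyc hz'
    push Not at hy' hz'
    obtain ⟨y'', hy'', hyy⟩ := hy'
    obtain ⟨z'', hz'', hzz⟩ := hz'
    exact h.exists_realizes_of_one_three_three hac hc hh hx hy hz hyc hzc hy'' hz'' hyy hzz
  · push Not at hx
    obtain ⟨x', hx', hxc⟩ := hx
    exact h.exists_realizes_of_two_two_two hac hc hh hx' hy hz hxc hyc hzc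

open Classical in
theorem _root_.sum_adjNat_mul (v : V) (δ : V → ℕ) :
    ∑ w, Γ.adjNat v w * δ w = ∑ w with Γ.Adj v w, δ w := by
  simp [SimpleGraph.adjNat, Finset.sum_filter]

open Classical in
theorem _root_.card_filter_adj_le_two {v : V}
    (h : ∀ {p q w}, Γ.Adj v p → Γ.Adj v q → p ≠ q → Γ.Adj v w → w = p ∨ w = q) :
    (Finset.univ.filter fun w => Γ.Adj v w).card ≤ 2 := by
  by_contra! hcon
  obtain ⟨p, hp, q, hq, w, hw, hpq, hpw, hqw⟩ := Finset.two_lt_card.1 hcon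
  simp only [Finset.mem_filter, Finset.mem_univ, true_and] at hp hq hw
  rcases h hp hq hpq hw with rfl | rfl
  exacts [hpw rfl, hqw rfl]

/-- With two arms of length one the graph is of type D. The vector with 1 on these two leaves and 2
elsewhere is superharmonic: at `c` the neighbour sum is 2 + 1 + 1 = 4, and any other vertex has at
most two neighbours. -/
theorem not_isHyperbolicMatrix_of_one_one (h : IsBranch Γ c x y z)
    (hy : ∀ v, Γ.Adj y v → v = c) (hz : ∀ v, Γ.Adj z v → v = c) :
    ¬ IsHyperbolicMatrix Γ.adjNat := by
  classical
  rintro ⟨⟨f, hf⟩, -⟩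
  let δ : V → ℕ := fun v => if v = y ∨ v = z then 1 else 2
  have hδ2 : ∀ v, δ v ≤ 2 := fun v => by
    simp only [δ]
    split_ifs <;> omega
  refine absurd (cartanForm_nonneg_of_superharmonic Γ.adjNat_comm δ (fun v _ => ?_) f
    fun v hv => ?_) (not_le.2 hf)
  · rw [sum_adjNat_mul]
    by_cases hvyz : v = y ∨ v = z
    · have hsub : Finset.univ.filter (Γ.Adj v) ⊆ {c} := by
        intro w hw
        simp only [Finset.mem_filter, Finset.mem_univ, true_and] at hw
        rcases hvyz with rfl | rfl
        · simp [hy w hw]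
        · simp [hz w hw]
      refine (Finset.sum_le_sum_of_subset hsub).trans ?_
      simpa [δ, hvyz] using hδ2 c
    by_cases hvc : v = c
    · subst hvc
      have hsub : Finset.univ.filter (Γ.Adj v) ⊆ {x, y, z} := by
        intro w hw
        simp only [Finset.mem_filter, Finset.mem_univ, true_and] at hw
        simpa using h.7 hw
      refine (Finset.sum_le_sum_of_subset hsub).trans ?_
      rw [Finset.sum_insert (by simp [h.4, h.5]), Finset.sum_insert (by simp [h.6]),
        Finset.sum_singleton]
      simp [δ, hvyz, h.4, h.5]
    · refine (Finset.sum_le_card_nsmul _ _ 2 fun w _ => hδ2 w).trans ?_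
      have := card_filter_adj_le_two (h.8 hvc)
      have h2 : δ v = 2 := if_neg hvyz
      rw [smul_eq_mul, h2]
      omega
  · simp only [δ] at hv
    split_ifs at hv

theorem exists_realizes (h : IsBranch Γ c x y z) (hac : Γ.IsAcyclic)
    (hc : IsConnectedMatrix Γ.adjNat) (hh : IsHyperbolicMatrix Γ.adjNat) :
    ∃ D : HypDiagram, D.IsListed ∧ Realizes Γ.adjNat D := by
  by_cases hx : ∀ v, Γ.Adj x v → v = c <;> by_cases hy : ∀ v, Γ.Adj y v → v = c <;>
    by_cases hz : ∀ v, Γ.Adj z v → v = c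
  · exact absurd hh (h.not_isHyperbolicMatrix_of_one_one hy hz)
  · exact absurd hh (h.cycle.cycle.not_isHyperbolicMatrix_of_one_one hx hy)
  · exact absurd hh (h.cycle.not_isHyperbolicMatrix_of_one_one hz hx)
  · push Not at hy hz
    obtain ⟨y', hy, hyc⟩ := hy
    obtain ⟨z', hz, hzc⟩ := hz
    exact h.exists_realizes_of_two_two hac hc hh hy hz hyc hzc
  · exact absurd hh (h.not_isHyperbolicMatrix_of_one_one hy hz)
  · push Not at hx hz
    obtain ⟨x', hx, hxc⟩ := hx
    obtain ⟨z', hz, hzc⟩ := hz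
    exact h.cycle.exists_realizes_of_two_two hac hc hh hz hx hzc hxc
  all_goals
    push Not at hx hy
    obtain ⟨x', hx, hxc⟩ := hx
    obtain ⟨y', hy, hyc⟩ := hy
    exact h.cycle.cycle.exists_realizes_of_two_two hac hc hh hx hy hxc hyc

end IsBranch

end Branch

/-! ### Forked paths, that is, extended D diagrams in a tree -/

section TwoBranches

variable {V : Type*} {Γ : SimpleGraph V}

theorem isTreeIn_of_isChain {P : List V} (hP : P ≠ []) (hc : P.IsChain Γ.Adj) (hn : P.Nodup) :
    IsTreeIn Γ (List.range (P.length - 1)) P := by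
  induction P using List.reverseRecOn with
  | nil => exact absurd rfl hP
  | append_singleton P v ih =>
    rcases List.eq_nil_or_concat P with rfl | ⟨Q, u, rfl⟩
    · exact .single v
    rw [List.concat_eq_append] at *
    rw [List.isChain_append] at hc
    rw [List.nodup_append] at hn
    have h := (ih (by simp) hc.1 hn.1).snoc Q.length (u := u) (v := v) (by simp)
      (hc.2.2 u (by simp) v (by simp)) fun hv => hn.2.2 v hv v (by simp) rfl
    simpa [List.range_succ] using h

theorem connected_of_isConnectedMatrix (hc : IsConnectedMatrix Γ.adjNat) : Γ.Connected := by
  have := hc.1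
  refine ⟨fun u v => ?_⟩
  have h := hc.2 {v | Γ.Reachable u v} ⟨u, .refl u⟩ fun a ha b hab =>
    SimpleGraph.Reachable.trans ha (SimpleGraph.adjNat_ne_zero.1 hab).reachable
  have h2 := Set.mem_univ v
  rwa [← h] at h2

/-- The path `P` with two further vertices `x`, `y` joined to its first vertex and two further
vertices `z`, `w` joined to its last vertex. -/
structure IsForkedPath (Γ : SimpleGraph V) (x y : V) (P : List V) (z w : V) : Prop where
  ne_nil : P ≠ []
  isChain : P.IsChain Γ.Adj
  nodup : (x :: y :: z :: w :: P).Nodup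
  head : ∀ p ∈ P.head?, Γ.Adj p x ∧ Γ.Adj p y
  last : ∀ p ∈ P.getLast?, Γ.Adj p z ∧ Γ.Adj p w

namespace IsForkedPath

variable {x y z w : V} {P : List V}

theorem swap (h : IsForkedPath Γ x y P z w) : IsForkedPath Γ y x P z w :=
  ⟨h.1, h.2, (List.Perm.swap _ _ _).nodup_iff.1 h.3, fun p hp => (h.4 p hp).symm, h.5⟩

theorem reverse (h : IsForkedPath Γ x y P z w) : IsForkedPath Γ z w P.reverse x y := by
  refine ⟨by simpa using h.1, ?_, ?_, by simpa using h.5, by simpa using h.4⟩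
  · rw [List.isChain_reverse]
    exact h.2.imp fun _ _ e => e.symm
  · have := h.3
    simp only [List.nodup_cons, List.mem_cons, List.mem_reverse, List.nodup_reverse, not_or] at *
    grind

theorem isTreeIn (h : IsForkedPath Γ x y P z w) :
    IsTreeIn Γ (List.range (P.length - 1) ++ [0] ++ [0] ++ [P.length - 1] ++ [P.length - 1])
      (P ++ [x] ++ [y] ++ [z] ++ [w]) := by
  have hn := h.3
  simp only [List.nodup_cons, List.mem_cons, not_or] at hn
  obtain ⟨p, hp⟩ : ∃ p, P.head? = some p := by
    rcases P with _ | ⟨p, P⟩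
    exacts [absurd rfl h.1, ⟨p, rfl⟩]
  obtain ⟨q, hq⟩ : ∃ q, P.getLast? = some q := ⟨_, List.getLast?_eq_getLast_of_ne_nil h.1⟩
  have hp0 : P[0]? = some p := by rwa [← List.head?_eq_getElem?]
  have hq0 : P[P.length - 1]? = some q := by rwa [← List.getLast?_eq_getElem?]
  have hlen : 0 < P.length := List.length_pos_iff.2 h.1
  have T := isTreeIn_of_isChain h.1 h.2 (by tauto)
  have T1 := T.snoc 0 hp0 (h.4 p hp).1 (by tauto)
  have T2 := T1.snoc 0 (by rw [List.getElem?_append_left hlen, hp0]) (h.4 p hp).2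
    (by grind)
  have T3 := T2.snoc (P.length - 1) (u := q) (by
    rw [List.getElem?_append_left (by simp), List.getElem?_append_left (by omega), hq0])
    (h.5 q hq).1 (by grind)
  exact T3.snoc (P.length - 1) (u := q) (by
    rw [List.getElem?_append_left (by simp; omega), List.getElem?_append_left (by simp),
      List.getElem?_append_left (by omega), hq0]) (h.5 q hq).2 (by grind)

open Classical in
/-- The weight of a vertex in the radical vector of a forked path. -/
noncomputable def weight (x y : V) (P : List V) (z w : V) (v : V) : ℕ :=
  if v ∈ P then 2 else if v = x ∨ v = y ∨ v = z ∨ v = w then 1 else 0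

variable [Fintype V]

theorem _root_.sum_map_le_sum_adjNat_mul {v : V} (δ : V → ℕ) {M : List V} (hM : M.Nodup)
    (hv : ∀ u ∈ M, Γ.Adj v u) : (M.map δ).sum ≤ ∑ u, Γ.adjNat v u * δ u := by
  classical
  rw [sum_adjNat_mul, ← List.sum_toFinset _ hM]
  exact Finset.sum_le_sum_of_subset fun u hu => by simpa using hv u (by simpa using hu)

/-- A vertex of the spine has two neighbours of weight 2, with a pair of leaves replacing each
missing one at an end; a leaf has a neighbour of weight 2. Only these neighbours are exhibited, so
this is merely a lower bound for the full neighbour sum. -/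
theorem two_mul_weight_le (h : IsForkedPath Γ x y P z w) {v : V}
    (hv : v ∈ P ∨ v = x ∨ v = y ∨ v = z ∨ v = w) :
    2 * weight x y P z w v ≤ ∑ u, Γ.adjNat v u * weight x y P z w u := by
  have hn := h.3
  simp only [List.nodup_cons, List.mem_cons, not_or] at hn
  have hP : ∀ {u}, u ∈ P → weight x y P z w u = 2 := fun hu => if_pos hu
  have hx : weight x y P z w x = 1 := by simp [weight, hn]
  have hy : weight x y P z w y = 1 := by simp [weight, hn]
  have hz : weight x y P z w z = 1 := by simp [weight, hn]
  have hw : weight x y P z w w = 1 := by simp [weight, hn]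
  have leaf : ∀ {u p}, p ∈ P → weight x y P z w u = 1 → Γ.Adj p u →
      2 * weight x y P z w u ≤ ∑ t, Γ.adjNat u t * weight x y P z w t := by
    intro u p hp hu hpu
    have := sum_map_le_sum_adjNat_mul (weight x y P z w) (List.nodup_singleton p)
      (by simpa using hpu.symm)
    simpa [hu, hP hp] using this
  have hhead : ∃ p ∈ P, Γ.Adj p x ∧ Γ.Adj p y := by
    rcases P with _ | ⟨p, P⟩
    exacts [absurd rfl h.1, ⟨p, by simp, h.4 p rfl⟩]
  have hlast : ∃ p ∈ P, Γ.Adj p z ∧ Γ.Adj p w :=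
    ⟨_, List.getLast_mem h.1, h.5 _ (List.getLast?_eq_getLast_of_ne_nil h.1)⟩
  obtain ⟨p, hp, hpx, hpy⟩ := hhead
  obtain ⟨q, hq, hqz, hqw⟩ := hlast
  generalize weight x y P z w = W at *
  rcases hv with hv | rfl | rfl | rfl | rfl
  · rw [hP hv]
    obtain ⟨P₁, P₂, rfl⟩ := List.append_of_mem hv
    have hch := h.2
    have hd := h.4
    have hl := h.5
    have key : ∀ M : List V, M.Nodup → (∀ u ∈ M, Γ.Adj v u) → (M.map W).sum = 4 →
        2 * 2 ≤ ∑ u, Γ.adjNat v u * W u := fun M h1 h2 h3 =>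
      h3.symm.le.trans (sum_map_le_sum_adjNat_mul W h1 h2)
    rcases List.eq_nil_or_concat P₁ with rfl | ⟨Q, s, rfl⟩ <;> rcases P₂ with _ | ⟨t, P₂⟩
    · have h1 := hd v rfl
      have h2 := hl v rfl
      exact key [x, y, z, w] (by simp; tauto) (by simp; tauto) (by simp [hx, hy, hz, hw])
    · have h1 := hd v rfl
      have h2 : Γ.Adj v t := by
        rw [List.nil_append, List.isChain_cons_cons] at hch
        exact hch.1
      exact key [x, y, t] (by simp at hn ⊢; tauto) (by simp; tauto)
        (by simp [hx, hy, hP (u := t)])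
    · have h1 := hl v (by simp)
      have h2 : Γ.Adj v s := by
        rw [List.isChain_append] at hch
        exact (hch.2.2 s (by simp) v (by simp)).symm
      exact key [s, z, w] (by simp at hn ⊢; tauto) (by simp; tauto)
        (by simp [hz, hw, hP (u := s)])
    · have h1 : Γ.Adj v s := by
        rw [List.isChain_append] at hch
        exact (hch.2.2 s (by simp) v (by simp)).symm
      have h2 : Γ.Adj v t := by
        rw [List.isChain_append, List.isChain_cons_cons] at hch
        exact hch.2.1.1
      exact key [s, t] (by simp [List.nodup_append] at hn ⊢; grind) (by simp; tauto)
        (by simp [hP (u := s), hP (u := t)])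
  · exact leaf hp hx hpx
  · exact leaf hp hy hpy
  · exact leaf hq hz hqz
  · exact leaf hq hw hqw

/-- Counting edges shows that the lower bound of `two_mul_weight_le` is attained. Let n be the
number of vertices. If the forked path covers the graph, the total weight is 2n − 4. A tree has
degree sum 2(n − 1), and the four leaves have degree at least 1, so the sum of AW is at most 4(n −
1) − 4, twice the total weight. Hence 2W = AW at every vertex, W is superharmonic, and the graph is
not wild. -/
theorem not_cover (h : IsForkedPath Γ x y P z w) (hac : Γ.IsAcyclic)
    (hc : IsConnectedMatrix Γ.adjNat) (hh : IsHyperbolicMatrix Γ.adjNat) :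
    ¬ ∀ v, v ∈ P ∨ v = x ∨ v = y ∨ v = z ∨ v = w := by
  classical
  intro hcov
  have hn := h.3
  simp only [List.nodup_cons, List.mem_cons, not_or] at hn
  let W := weight x y P z w
  have hle : ∀ v ∈ Finset.univ, 2 * W v ≤ ∑ u, Γ.adjNat v u * W u := fun v _ =>
    h.two_mul_weight_le (hcov v)
  have hW : ∀ v, W v + (if v ∈ ({x, y, z, w} : Finset V) then 1 else 0) = 2 := by
    intro v
    simp only [W, weight, Finset.mem_insert, Finset.mem_singleton]
    by_cases hv : v ∈ P
    · have : ¬ (v = x ∨ v = y ∨ v = z ∨ v = w) := by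
        rintro (rfl | rfl | rfl | rfl) <;> tauto
      simp [hv, this]
    · have := (hcov v).resolve_left hv
      simp [hv, this]
  have hW0 : ∀ v, W v ≠ 0 := fun v h0 => by
    have := hW v
    split_ifs at this <;> omega
  have hdeg : ∀ v, ∑ u, Γ.adjNat v u = Γ.degree v := fun v => by
    simp [SimpleGraph.adjNat, ← SimpleGraph.card_neighborFinset_eq_degree,
      SimpleGraph.neighborFinset_eq_filter]
  have hdeg1 : ∀ v, 1 ≤ Γ.degree v := by
    intro v
    by_contra! h0
    rw [Nat.lt_one_iff, ← hdeg, Finset.sum_eq_zero_iff] at h0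
    have h1 := hle v (Finset.mem_univ v)
    rw [Finset.sum_eq_zero fun u hu => by rw [h0 u hu, zero_mul]] at h1
    have := hW0 v
    omega
  have hcard : ({x, y, z, w} : Finset V).card = 4 := by
    rw [Finset.card_insert_of_notMem (by simp; tauto), Finset.card_insert_of_notMem (by simp; tauto),
      Finset.card_pair (by tauto)]
  have hedge := (SimpleGraph.IsTree.mk (connected_of_isConnectedMatrix hc) hac).card_edgeFinset
  have hsum := Γ.sum_degrees_eq_twice_card_edges
  have s1 : ∑ v, W v + 4 = 2 * Fintype.card V := by
    have : ∑ v, (W v + if v ∈ ({x, y, z, w} : Finset V) then 1 else 0) = ∑ v : V, 2 :=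
      Finset.sum_congr rfl fun v _ => hW v
    rw [Finset.sum_add_distrib, Finset.sum_boole, Finset.filter_univ_mem, hcard] at this
    simpa [mul_comm] using this
  have s2 : ∑ v, W v * Γ.degree v + 4 ≤ 2 * ∑ v, Γ.degree v := by
    have e : ∑ v, (W v + if v ∈ ({x, y, z, w} : Finset V) then 1 else 0) * Γ.degree v =
        2 * ∑ v, Γ.degree v := by
      rw [Finset.mul_sum]
      exact Finset.sum_congr rfl fun v _ => by rw [hW]
    simp only [add_mul, Finset.sum_add_distrib] at e
    rw [← e]
    refine Nat.add_le_add_left ?_ _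
    calc 4 = ∑ v : V, if v ∈ ({x, y, z, w} : Finset V) then 1 else 0 := by
          rw [Finset.sum_boole, Finset.filter_univ_mem, hcard]; rfl
      _ ≤ _ := Finset.sum_le_sum fun v _ => by
          have := hdeg1 v
          split_ifs <;> omega
  have s3 : ∑ v, ∑ u, Γ.adjNat v u * W u = ∑ v, W v * Γ.degree v := by
    rw [Finset.sum_comm]
    refine Finset.sum_congr rfl fun v _ => ?_
    rw [← Finset.sum_mul, ← hdeg, mul_comm]
    simp_rw [Γ.adjNat_comm v]
  have s4 : ∑ v, 2 * W v = ∑ v, ∑ u, Γ.adjNat v u * W u := by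
    refine le_antisymm (Finset.sum_le_sum hle) ?_
    rw [← Finset.mul_sum]
    omega
  obtain ⟨f, hf⟩ := hh.1
  exact absurd (cartanForm_nonneg_of_superharmonic Γ.adjNat_comm W (fun v _ =>
    ((Finset.sum_eq_sum_iff_of_le hle).1 s4 v (Finset.mem_univ v)).symm.le) f
    fun v hv => absurd hv (hW0 v)) (not_le.2 hf)

end IsForkedPath

end TwoBranches

/-! ### Classification of trees -/

section Acyclic

variable {V : Type*} {Γ : SimpleGraph V}

namespace IsForkedPath

variable [Fintype V] {x y z w : V} {P : List V}

theorem exists_of_card_le (h : IsForkedPath Γ x y P z w) (hac : Γ.IsAcyclic)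
    (hc : IsConnectedMatrix Γ.adjNat) (hh : IsHyperbolicMatrix Γ.adjNat) :
    ∃ v ∉ P ++ [x] ++ [y] ++ [z] ++ [w], (∃ u ∈ P ++ [x] ++ [y] ++ [z] ++ [w], Γ.Adj u v) ∧
      ∀ t, t ∈ P ++ [x] ++ [y] ++ [z] ++ [w] ++ [v] := by
  classical
  have hmem : ∀ v, v ∈ P ++ [x] ++ [y] ++ [z] ++ [w] ↔ v ∈ P ∨ v = x ∨ v = y ∨ v = z ∨ v = w := by
    simp
  have hW : ∀ v, v ∈ (P ++ [x] ++ [y] ++ [z] ++ [w]).toFinset ↔ weight x y P z w v ≠ 0 := by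
    intro v
    rw [List.mem_toFinset, hmem, weight]
    split_ifs <;> simp_all
  rcases card_le_of_subharmonic Γ.adjNat_comm hc hh hW ⟨x, by simp⟩ (fun v hv => by
    rw [List.mem_toFinset, hmem] at hv
    exact h.two_mul_weight_le hv) with h1 | ⟨v, hv, ⟨u, hu, huv⟩, hall⟩
  · exact absurd (fun v => (hmem v).1 (List.mem_toFinset.1 (h1 ▸ Finset.mem_univ v)))
      (h.not_cover hac hc hh)
  · rw [List.mem_toFinset] at hv hu
    refine ⟨v, hv, ⟨u, hu, SimpleGraph.adjNat_ne_zero.1 huv⟩, fun t => ?_⟩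
    have := hall t
    rw [Finset.mem_insert, List.mem_toFinset] at this
    exact List.mem_append.2 (this.symm.imp_right (by simp))

/-- With six vertices on the spine and a vertex `v` beyond the leaf `x`, the first spine vertex is
the centre of an extended E8 with arms `y`, then `x, v`, then five spine vertices. It misses both
`z` and `w`. -/
theorem length_le_five (h : IsForkedPath Γ x y P z w) (hc : IsConnectedMatrix Γ.adjNat)
    (hh : IsHyperbolicMatrix Γ.adjNat) {v : V} (hv : v ∉ P ++ [x] ++ [y] ++ [z] ++ [w])
    (hxv : Γ.Adj x v) : P.length ≤ 5 := by
  by_contra! hlen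
  obtain ⟨p₁, p₂, p₃, p₄, p₅, p₆, Q, rfl⟩ : ∃ p₁ p₂ p₃ p₄ p₅ p₆ Q,
      P = p₁ :: p₂ :: p₃ :: p₄ :: p₅ :: p₆ :: Q := by
    rcases P with _ | ⟨p₁, _ | ⟨p₂, _ | ⟨p₃, _ | ⟨p₄, _ | ⟨p₅, _ | ⟨p₆, Q⟩⟩⟩⟩⟩⟩
    all_goals first | exact ⟨_, _, _, _, _, _, _, rfl⟩ | (simp at hlen)
  obtain ⟨hx, hy⟩ := h.4 p₁ rfl
  have hn := h.3
  have hch := h.2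
  simp only [List.isChain_cons_cons] at hch
  obtain ⟨a₁, a₂, a₃, a₄, a₅, -⟩ := hch
  simp only [List.nodup_cons, List.mem_cons, not_or] at hn
  simp only [List.mem_append, List.mem_cons, List.not_mem_nil, or_false, not_or] at hv
  have hzw : z ≠ w := hn.2.2.1.1
  have hz : z ∉ [p₁, y, x, v, p₂, p₃, p₄, p₅, p₆] := by
    simp only [List.mem_cons, List.not_mem_nil, or_false, not_or, eq_comm (a := z)] at hn hv ⊢
    tauto
  have hw : w ∉ [p₁, y, x, v, p₂, p₃, p₄, p₅, p₆] := by
    simp only [List.mem_cons, List.not_mem_nil, or_false, not_or, eq_comm (a := w)] at hn hv ⊢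
    tauto
  have T := ((((((((IsTreeIn.single p₁).snoc 0 rfl hy (by grind)).snoc 0 rfl hx
    (by grind)).snoc 2 rfl hxv (by grind)).snoc 0 rfl a₁ (by grind)).snoc 4 rfl a₂
    (by grind)).snoc 5 rfl a₃ (by grind)).snoc 6 rfl a₄ (by grind)).snoc 7 rfl a₅ (by grind)
  rcases T.cover_or_exists hc hh [6, 3, 4, 2, 5, 4, 3, 2, 1] (by decide) with h1 | ⟨t, -, -, h1⟩
  · exact hz (h1 z)
  · have e := ((h1 z).resolve_right hz).trans ((h1 w).resolve_right hw).symm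
    exact hzw (by simpa using e)

theorem exists_realizes_of_adj_fst (h : IsForkedPath Γ x y P z w) (hac : Γ.IsAcyclic)
    (hc : IsConnectedMatrix Γ.adjNat) (hh : IsHyperbolicMatrix Γ.adjNat) {v : V}
    (hv : v ∉ P ++ [x] ++ [y] ++ [z] ++ [w]) (hxv : Γ.Adj x v)
    (hall : ∀ t, t ∈ P ++ [x] ++ [y] ++ [z] ++ [w] ++ [v]) :
    ∃ D : HypDiagram, D.IsListed ∧ Realizes Γ.adjNat D := by
  have h5 := h.length_le_five hc hh hv hxv
  have h1 : 1 ≤ P.length := List.length_pos_iff.2 h.1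
  have T := h.isTreeIn.snoc P.length (by simp) hxv hv
  refine ⟨overext (.D (P.length + 3)), ⟨by omega, by omega⟩, ?_⟩
  clear h hv hxv
  generalize P.length = k at *
  interval_cases k
  · exact T.realizes hac hall _ rfl [1, 2, 0, 3, 4, 5] (by decide +kernel)
  · exact T.realizes hac hall _ rfl [2, 3, 0, 1, 4, 5, 6] (by decide +kernel)
  · exact T.realizes hac hall _ rfl [3, 4, 0, 1, 2, 5, 6, 7] (by decide +kernel)
  · exact T.realizes hac hall _ rfl [4, 5, 0, 1, 2, 3, 6, 7, 8] (by decide +kernel)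
  · exact T.realizes hac hall _ rfl [5, 6, 0, 1, 2, 3, 4, 7, 8, 9] (by decide +kernel)

/-- The one remaining vertex `v` is attached to a leaf or to the spine. On a leaf it gives an
overextended D diagram, up to the symmetries of the fork. On a spine of more than one vertex it
creates a forked path with shorter spine, against minimality; on a spine of one vertex it gives the
star with five leaves. -/
theorem exists_realizes (h : IsForkedPath Γ x y P z w) (hac : Γ.IsAcyclic)
    (hc : IsConnectedMatrix Γ.adjNat) (hh : IsHyperbolicMatrix Γ.adjNat)
    (hmin : ∀ x y P' z w, IsForkedPath Γ x y P' z w → P.length ≤ P'.length) :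
    ∃ D : HypDiagram, D.IsListed ∧ Realizes Γ.adjNat D := by
  obtain ⟨v, hv, ⟨u, hu, huv⟩, hall⟩ := h.exists_of_card_le hac hc hh
  have hn := h.3
  have hch := h.2
  simp only [List.nodup_cons, List.mem_cons, not_or] at hn
  simp only [List.mem_append, List.mem_cons, List.not_mem_nil, or_false] at hu
  rcases hu with (((hu | rfl) | rfl) | rfl) | rfl
  · obtain ⟨P₁, P₂, rfl⟩ := List.append_of_mem hu
    have hl := h.5
    have hd := h.4
    simp only [List.mem_append, List.mem_cons, List.not_mem_nil, or_false, not_or] at hv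
    rcases P₂ with _ | ⟨s, P₂⟩
    · replace hl := hl u (by simp)
      rcases List.eq_nil_or_concat P₁ with rfl | ⟨Q, s, rfl⟩
      · replace hd := hd u rfl
        have h1 := hd.1.ne
        have h2 := hd.2.ne
        have h3 := hl.1.ne
        have h4 := hl.2.ne
        have T := (((((IsTreeIn.single u).snoc 0 rfl hd.1 (by grind)).snoc 0 rfl hd.2
          (by grind)).snoc 0 rfl hl.1 (by grind)).snoc 0 rfl hl.2 (by grind)).snoc 0 rfl huv
          (by simp at hv ⊢; tauto)
        exact ⟨star5, trivial, T.realizes hac hall _ rfl [0, 1, 2, 3, 4, 5] (by decide +kernel)⟩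
      · have hs : Γ.Adj u s := by
          rw [List.isChain_append] at hch
          exact (hch.2.2 s (by simp) u (by simp)).symm
        -- At the last vertex of a longer spine, `u` has the four neighbours `v, s, z, w` and alone
        -- serves as a spine.
        have := hmin v s [u] z w ⟨by simp, by simp, by grind, by simpa using ⟨huv, hs⟩,
          by simpa using hl⟩
        simp at this
    · have hs : Γ.Adj u s := by
        rw [List.isChain_append, List.isChain_cons_cons] at hch
        exact hch.2.1.1
      -- The spine is cut after `u`, with `v` and the next spine vertex `s` as the new pair of
      -- leaves.
      have := hmin x y (P₁ ++ [u]) v s ⟨by simp, ?_, by grind, ?_, by simpa using ⟨huv, hs⟩⟩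
      · simp at this
      · rw [List.isChain_append] at hch ⊢
        exact ⟨hch.1, by simp, fun a ha b hb => hch.2.2 a ha b (by simpa using hb)⟩
      · intro p hp
        refine hd p ?_
        rcases P₁ with _ | ⟨q, P₁⟩ <;> simpa using hp
  · exact h.exists_realizes_of_adj_fst hac hc hh hv huv hall
  · refine h.swap.exists_realizes_of_adj_fst hac hc hh ?_ huv fun t => ?_
    · grind
    · have := hall t
      grind
  · refine h.reverse.exists_realizes_of_adj_fst hac hc hh ?_ huv fun t => ?_
    · grind
    · have := hall t
      grind
  · refine h.reverse.swap.exists_realizes_of_adj_fst hac hc hh ?_ huv fun t => ?_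
    · grind
    · have := hall t
      grind

end IsForkedPath

/-- The spine is the path from `u` to `w`. Each end has at least two neighbours other than its
neighbour on the path; acyclicity keeps them off the path and distinct from those chosen at the
other end. -/
theorem exists_isForkedPath {u w a b c a' b' c' : V} (hac : Γ.IsAcyclic) (hconn : Γ.Connected)
    (huw : u ≠ w) (ha : Γ.Adj u a) (hb : Γ.Adj u b) (hc : Γ.Adj u c) (hab : a ≠ b) (hac' : a ≠ c)
    (hbc : b ≠ c) (ha' : Γ.Adj w a') (hb' : Γ.Adj w b') (hc' : Γ.Adj w c') (hab' : a' ≠ b')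
    (hac'' : a' ≠ c') (hbc' : b' ≠ c') : ∃ x y P z t, IsForkedPath Γ x y P z t := by
  classical
  obtain ⟨q, hq⟩ := (hconn u w).exists_isPath
  have pick : ∀ {v s : V} {p₁ p₂ p₃ : V}, Γ.Adj v p₁ → Γ.Adj v p₂ → Γ.Adj v p₃ → p₁ ≠ p₂ → p₁ ≠ p₃ →
      p₂ ≠ p₃ → ∃ x y, Γ.Adj v x ∧ Γ.Adj v y ∧ x ≠ y ∧ x ≠ s ∧ y ≠ s := by
    intro v s p₁ p₂ p₃ h1 h2 h3 h12 h13 h23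
    by_cases e1 : p₁ = s
    · exact ⟨p₂, p₃, h2, h3, h23, by grind, by grind⟩
    by_cases e2 : p₂ = s
    · exact ⟨p₁, p₃, h1, h3, h13, by grind, by grind⟩
    · exact ⟨p₁, p₂, h1, h2, h12, e1, e2⟩
  obtain ⟨x, y, hx, hy, hxy, hxs, hys⟩ := pick (s := q.snd) ha hb hc hab hac' hbc
  obtain ⟨z, t, hz, ht, hzt, hzs, hts⟩ := pick (s := q.penultimate) ha' hb' hc' hab' hac'' hbc'
  have hxq : x ∉ q.support := fun h => hxs (hac.eq_snd_of_adj_start hq hx h)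
  have hyq : y ∉ q.support := fun h => hys (hac.eq_snd_of_adj_start hq hy h)
  have hzq : z ∉ q.support := fun h => hzs (hac.eq_penultimate_of_adj_end hq hz h)
  have htq : t ∉ q.support := fun h => hts (hac.eq_penultimate_of_adj_end hq ht h)
  -- A common neighbour off the path would close it to a cycle: on the path from `r` through `u` to
  -- `w`, the vertex `w` is adjacent to the start, hence is the second vertex `u`.
  have hne : ∀ {r s}, Γ.Adj u r → Γ.Adj w s → r ∉ q.support → r ≠ s := by
    rintro r _ hr hs hrq rfl
    have hp : (q.concat hs).IsPath := hq.concat hrq hs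
    have h1 := hac.eq_snd_of_adj_start hp hr (by simp)
    have h2 : (SimpleGraph.Walk.cons hr.symm q).IsPath :=
      (SimpleGraph.Walk.cons_isPath_iff _ _).2 ⟨hq, hrq⟩
    have h3 := hac.eq_snd_of_adj_start h2 hs.symm (by simp)
    simp only [SimpleGraph.Walk.snd_cons] at h3
    exact huw h3.symm
  refine ⟨x, y, q.support, z, t, by simp, q.isChain_adj_support, ?_, ?_, ?_⟩
  · have := hq.support_nodup
    have e1 := hne hx hz hxq
    have e2 := hne hx ht hxq
    have e3 := hne hy hz hyq
    have e4 := hne hy ht hyq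
    simp only [List.nodup_cons, List.mem_cons, not_or]
    tauto
  · intro p hp
    rw [← SimpleGraph.Walk.cons_tail_support] at hp
    simp only [List.head?_cons, Option.mem_def, Option.some.injEq] at hp
    exact hp ▸ ⟨hx, hy⟩
  · intro p hp
    rw [List.getLast?_eq_getLast_of_ne_nil (by simp)] at hp
    simp only [SimpleGraph.Walk.getLast_support, Option.mem_def, Option.some.injEq] at hp
    exact hp ▸ ⟨hz, ht⟩

/-- Without a forked path, a vertex with three neighbours has no fourth, since it would itself be a
spine, and no other vertex has three, by `exists_isForkedPath`; this is the situation of `IsBranch`.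
If no vertex has three neighbours, the all-ones vector is superharmonic. -/
theorem exists_realizes_of_isAcyclic [Fintype V] (hac : Γ.IsAcyclic) (hc : IsConnectedMatrix Γ.adjNat)
    (hh : IsHyperbolicMatrix Γ.adjNat) : ∃ D : HypDiagram, D.IsListed ∧ Realizes Γ.adjNat D := by
  classical
  by_cases hF : ∃ n x y P z w, IsForkedPath Γ x y P z w ∧ P.length = n
  · obtain ⟨x, y, P, z, w, h, hP⟩ := Nat.find_spec hF
    exact h.exists_realizes hac hc hh fun x' y' P' z' w' h' =>
      hP ▸ Nat.find_min' hF ⟨x', y', P', z', w', h', rfl⟩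
  replace hF : ∀ x y P z w, ¬ IsForkedPath Γ x y P z w := fun x y P z w h =>
    hF ⟨_, x, y, P, z, w, h, rfl⟩
  by_cases hB : ∃ v p q r, Γ.Adj v p ∧ Γ.Adj v q ∧ Γ.Adj v r ∧ p ≠ q ∧ p ≠ r ∧ q ≠ r
  · obtain ⟨c, x, y, z, hx, hy, hz, hxy, hxz, hyz⟩ := hB
    refine IsBranch.exists_realizes (c := c) (x := x) (y := y) (z := z)
      ⟨hx, hy, hz, hxy, hxz, hyz, fun {v} hv => ?_, fun {u p q v} hu hp hq hpq hv => ?_⟩ hac hc hh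
    · by_contra! hcon
      refine hF x y [c] z v ⟨by simp, by simp, ?_, by simpa using ⟨hx, hy⟩, by simpa using ⟨hz, hv⟩⟩
      have e1 := hx.ne
      have e2 := hy.ne
      have e3 := hz.ne
      have e4 := hv.ne
      grind
    · by_contra! hcon
      obtain ⟨x', y', P, z', w', h⟩ := exists_isForkedPath hac (connected_of_isConnectedMatrix hc) hu
        hp hq hv hpq hcon.1.symm hcon.2.symm hx hy hz hxy hxz hyz
      exact hF _ _ _ _ _ h
  · exfalso
    obtain ⟨f, hf⟩ := hh.1
    refine absurd (cartanForm_nonneg_of_superharmonic Γ.adjNat_comm 1 (fun v _ => ?_) f (by simp))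
      (not_le.2 hf)
    rw [sum_adjNat_mul]
    simp only [Pi.one_apply, Finset.sum_const, smul_eq_mul, mul_one]
    refine card_filter_adj_le_two fun {p q w} hp hq hpq hw => ?_
    by_contra! hcon
    exact hB ⟨v, p, q, w, hp, hq, hw, hpq, hcon.1.symm, hcon.2.symm⟩

end Acyclic

/-! ### Assembly: classification, ranks and deletion of ∞ -/

namespace HypDiagram

theorem exists_realizes {V : Type*} [Fintype V] {a : V → V → ℕ} (ha : ∀ v w, a v w = a w v)
    (hd : ∀ v, Even (a v v)) (hc : IsConnectedMatrix a) (hh : IsHyperbolicMatrix a) :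
    ∃ D : HypDiagram, D.IsListed ∧ Realizes a D := by
  classical
  by_cases h0 : ∃ v, a v v ≠ 0
  · exact exists_realizes_of_loop ha hd hc hh h0.choose_spec
  push Not at h0
  by_cases h1 : ∃ u v, 2 ≤ a u v
  · obtain ⟨u, v, huv⟩ := h1
    exact exists_realizes_of_multiple_edge ha h0 hc hh huv
  push Not at h1
  let Γ : SimpleGraph V :=
    { Adj := fun v w => a v w ≠ 0
      symm := ⟨fun v w h => ha v w ▸ h⟩
      loopless := ⟨fun v h => h (h0 v)⟩ }
  have e : a = Γ.adjNat := by
    funext v w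
    have := h1 v w
    rw [SimpleGraph.adjNat]
    split_ifs with h
    · have : a v w ≠ 0 := h
      omega
    · exact not_not.1 h
  rw [e] at hc hh ⊢
  by_cases hac : Γ.IsAcyclic
  · exact exists_realizes_of_isAcyclic hac hc hh
  · have hex := exists_isCycleSeq_of_not_isAcyclic hac
    exact (Nat.find_spec hex).choose_spec.exists_realizes
      (fun m' c' h' => Nat.find_min' hex ⟨c', h'⟩) hc hh

theorem mem_table_iff (r : ℕ) (D : HypDiagram) : D ∈ table r ↔ D.IsListed ∧ D.graph.rank = r := by
  rw [graph_eq_ofEdges, Graph.ofEdges_rank]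
  rcases D with (n | n | _ | _ | _) | n | n | n | n | _ | _ | _ | _ | _ | _ | _ | _ <;>
    rcases r with _ | _ | _ | _ | _ | _ | _ | _ | _ | _ | _ | r <;>
    simp [table, IsListed, order, ExtendedADE.order] <;> omega

theorem IsListed.rank_le {D : HypDiagram} (h : D.IsListed) : D.graph.rank ≤ 10 := by
  by_contra! hr
  have := (mem_table_iff _ D).2 ⟨h, rfl⟩
  obtain ⟨k, hk⟩ := Nat.exists_eq_add_of_le hr
  rw [hk, Nat.add_comm] at this
  exact this

end HypDiagram

namespace Graph

variable {α β γ δ : Type*}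

theorem isConnected_and_isHyperbolic_iff {G : Graph α β} (hV : V(G).Finite) (hE : E(G).Finite) :
    G.IsConnected ∧ G.IsHyperbolic ↔ ∃ D : HypDiagram, D.IsListed ∧ G.IsIsomorphic D.graph := by
  have := hV.fintype
  simp only [isConnected_iff hE, isHyperbolic_iff, isIsomorphic_graph_iff hE]
  constructor
  · rintro ⟨hc, hh⟩
    exact exists_realizes G.adjCount_comm (fun v => by simp [adjCount]) hc hh
  · rintro ⟨D, hD, f, hf, h⟩
    have e : ∀ v w, G.adjCount v w =
        D.adj ((Equiv.ofBijective f hf).symm v) ((Equiv.ofBijective f hf).symm w) := fun v w => by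
      simp [← h, Equiv.ofBijective_apply_symm_apply f hf]
    exact ⟨.of_equiv _ e hD.isConnectedHyperbolic.1, .of_equiv _ e hD.isConnectedHyperbolic.2⟩

theorem IsIsomorphic.rank_eq {G : Graph α β} {H : Graph γ δ} (h : G.IsIsomorphic H) :
    G.rank = H.rank := by
  obtain ⟨f, -⟩ := h
  rw [rank, rank, ← Nat.card_coe_set_eq, ← Nat.card_coe_set_eq, Nat.card_congr f]

/-- The marked vertex ∞ always has the largest label, so deleting it leaves the labels 0, …, n − 1.
Only multiplicities are compared, because the edge lists may differ in order and orientation. -/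
theorem deleteVerts_last_isIsomorphic {n : ℕ} {l l' : List (ℕ × ℕ)}
    (h : ∀ i < n, ∀ j < n, edgeCount l i j = edgeCount l' i j) :
    ((ofEdges (n + 1) l).deleteVerts {n}).IsIsomorphic (ofEdges n l') := by
  have hV : V((ofEdges (n + 1) l).deleteVerts {n}) = {v | v < n} := by
    rw [vertexSet_deleteVerts]
    ext v
    simp only [ofEdges, Set.mem_sdiff, Set.mem_ofPred_eq, Set.mem_singleton_iff]
    omega
  have hi := deleteVerts_isInducedSubgraph (ofEdges (n + 1) l) {n}
  refine (isIsomorphic_ofEdges_iff ((ofEdges_edgeSet_finite _ _).subset hi.le.edgeSet_mono)).2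
    ⟨fun i => ⟨i, hV ▸ i.2⟩, ⟨fun i j hij => ?_, fun v => ?_⟩, fun i j => ?_⟩
  · simpa [Fin.ext_iff] using hij
  · exact ⟨⟨v, hV.subset v.2⟩, rfl⟩
  · rw [hi.adjCount_eq, ← h i i.2 j j.2]
    exact ofEdges_adjCount i.castSucc j.castSucc

end Graph

namespace HypDiagram

theorem edgeCount_edges_overext {X : ExtendedADE} (i j : ℕ) (hi : i < X.order) (hj : j < X.order) :
    edgeCount (overext X).edges i j = edgeCount X.edges i j := by
  rw [edgeCount, edgeCount, edges, List.countP_cons_of_neg]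
  simp only [decide_eq_true_eq, Prod.mk.injEq]
  omega

theorem IsListed.deleteVerts_overextendedVertex {D : HypDiagram} (hD : D.IsListed) {i : ℕ}
    {X : ExtendedADE} (h : D.overextendedVertex = some (i, X)) :
    i ∈ D.graph.vertexSet ∧ X.IsValid ∧ (D.graph.deleteVerts {i}).IsIsomorphic X.graph := by
  suffices hs : i = X.order ∧ D.order = X.order + 1 ∧ X.IsValid ∧ ∀ v < X.order, ∀ w < X.order,
      edgeCount D.edges v w = edgeCount X.edges v w by
    obtain ⟨rfl, ho, hX, hs⟩ := hs
    rw [graph_eq_ofEdges, ho]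
    exact ⟨Nat.lt_succ_self _, hX, Graph.deleteVerts_last_isIsomorphic hs⟩
  rcases D with X | n | n | n | n | _ | _ | _ | _ | _ | _ | _ | _ <;>
    simp only [overextendedVertex, Option.some.injEq, Prod.mk.injEq, reduceCtorEq] at h <;>
    obtain ⟨rfl, rfl⟩ := h
  · refine ⟨rfl, rfl, ?_, fun v hv w hw => edgeCount_edges_overext v w hv hw⟩
    rcases X with n | n | _ | _ | _
    exacts [hD.1, hD.1, trivial, trivial, trivial]
  · exact ⟨rfl, rfl, le_rfl, by decide⟩
  · exact ⟨rfl, rfl, Nat.le_succ 1, by decide⟩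
  · exact ⟨rfl, rfl, Nat.le_succ 1, by decide⟩
  · exact ⟨rfl, rfl, Nat.le_add_left 1 2, by decide⟩

end HypDiagram

theorem mainTheorem1 :
    (∀ (α : Type*) (β : Type*) (G : Graph α β), G.vertexSet.Finite → G.edgeSet.Finite →
      ((G.IsConnected ∧ G.IsHyperbolic) ↔
        ∃ D : HypDiagram, D.IsListed ∧ G.IsIsomorphic D.graph)) ∧
    (∀ (α : Type*) (β : Type*) (G : Graph α β), G.vertexSet.Finite → G.edgeSet.Finite →
      G.IsConnected → G.IsHyperbolic →
        G.rank ≤ 10 ∧ ∃ D ∈ HypDiagram.table G.rank, G.IsIsomorphic D.graph) ∧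
    (∀ (r : ℕ) (D : HypDiagram), D ∈ HypDiagram.table r ↔ D.IsListed ∧ D.graph.rank = r) ∧
    (∀ (D : HypDiagram) (i : ℕ) (X : ExtendedADE), D.IsListed →
      D.overextendedVertex = some (i, X) →
        i ∈ D.graph.vertexSet ∧ X.IsValid ∧
          (D.graph.deleteVerts {i}).IsIsomorphic X.graph) := by
  refine ⟨fun α β G hV hE => Graph.isConnected_and_isHyperbolic_iff hV hE,
    fun α β G hV hE hc hh => ?_, HypDiagram.mem_table_iff,
    fun D i X hD h => hD.deleteVerts_overextendedVertex h⟩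
  obtain ⟨D, hD, h⟩ := (Graph.isConnected_and_isHyperbolic_iff hV hE).1 ⟨hc, hh⟩
  rw [h.rank_eq]
  exact ⟨hD.rank_le, D, (HypDiagram.mem_table_iff _ D).2 ⟨hD, rfl⟩, h⟩
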